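/- **Setting.** Let $M$ be a Polish space with its Borel $\sigma$-algebra, and let $\mathbb M$ (resp. $\mathscr P$) be the set of finite (resp. probability) Borel measures on $M$, with the weak topology. Let $\lambda$ be a $\sigma$-finite Borel measure on $M$, put $\mathbb M^{ac}=\{\mu\in\mathbb M:\mu\ll\lambda\}$ and $\mathscr P^{ac}=\mathbb M^{ac}\cap\mathscr P$, and equip both with the total variation distance $$\rho_{var}(\mu,\nu)=\int_M\Big|\frac{d\mu}{d\lambda}-\frac{d\nu}{d\lambda}\Big|\,d\lambda$$ and its Borel $\sigma$-algebra. Let $C_b^{E,1}(\mathbb M)$ be the space of continuous bounded $u:\mathbb M\to\mathbb R$ for which the extrinsic derivative $$D^Eu(\mu)(x)=\lim_{\varepsilon\downarrow0}\frac{u(\mu+\varepsilon\delta_x)-u(\mu)}{\varepsilon}$$ exists in $\mathbb R$ for all $(\mu,x)\in\mathbb M\times M$ and is continuous and bounded on $\mathbb M\times M$. Let $C_b^{E,1}(\mathscr P)$ be the space of continuous bounded $u:\mathscr P\to\mathbb R$ for which the convexity extrinsic derivative $$\tilde D^Eu(\mu)(x)=\lim_{\varepsilon\downarrow0}\frac{u((1-\varepsilon)\mu+\varepsilon\delta_x)-u(\mu)}{\varepsilon}$$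 exists in $\mathbb R$ for all $(\mu,x)\in\mathscr P\times M$ and is continuous and bounded on $\mathscr P\times M$. **Dirichlet forms.** Let $E$ be $\mathbb M^{ac}$ or $\mathscr P^{ac}$ and $\Lambda$ a Borel probability measure on $E$. A (symmetric) Dirichlet form on $L^2(E,\Lambda)$ is a symmetric bilinear form $(\mathcal E,\mathcal D(\mathcal E))$ with dense domain containing the constants, such that $\mathcal E(u,u)\ge0$, the form $\mathcal E_1(u,v)=\mathcal E(u,v)+\int uv\,d\Lambda$ satisfies $|\mathcal E_1(u,v)|\le K\sqrt{\mathcal E_1(u,u)\,\mathcal E_1(v,v)}$ for some constant $K$, $\mathcal D(\mathcal E)$ is complete under $\mathcal E_1^{1/2}$, and $u\in\mathcal D(\mathcal E)$ implies $u^+\wedge1\in\mathcal D(\mathcal E)$ and $\mathcal E(u^+\wedge1,u^+\wedge1)\le\mathcal E(u,u)$. For open $O$ let $\mathrm{Cap}_1(O)=\inf\{\mathcal E_1(u,u):u\in\mathcal D(\mathcal E),\ u\ge1\ \Lambda\text{-a.e. on }O\}$ with $\inf\emptyset=\infty$, and for $A\subseteq E$ let $\mathrm{Cap}_1(A)$ be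 the infimum of $\mathrm{Cap}_1(O)$ over open $O\supseteq A$. A nest is a sequence of closed sets $K_n$ with $\mathrm{Cap}_1(E\setminus K_n)\to0$. A measurable function on $E$ is quasi-continuous if for some nest its restriction to every $K_n$ is continuous. The form is quasi-regular if (Q1) there is a nest of compact sets, (Q2) $\mathcal D(\mathcal E)$ has an $\mathcal E_1^{1/2}$-dense linear subspace whose elements have quasi-continuous $\Lambda$-versions, and (Q3) there are a set $N$ with $\mathrm{Cap}_1(N)=0$ and a sequence of quasi-continuous functions, with classes in $\mathcal D(\mathcal E)$, that separates the points of $E\setminus N$. **Theorem.** (1) Let $\Lambda$ be a Borel probability measure on $\mathbb M^{ac}$ and let $J$ be a $\sigma$-finite Borel measure on $\mathbb M^{ac}\times\mathbb M^{ac}$ with $$\int\big[1\wedge\rho_{var}(\gamma,\eta)^2\big]\,dJ(\gamma,\eta)<\infty,\qquad J\ll\Lambda\times\Lambda .$$ Then for $u,v\in C_b^{E,1}(\mathbb M)$ (restricted to $\mathbb M^{ac}$, where they belong to $L^2(\Lambda)$) the integral $$\mathcal E^J(u,v)=\int\big(u(\gamma)-u(\eta)\big)\big(v(\gamma)-v(\eta)\big)\,dJ(\gamma,\eta)$$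 converges absolutely, and $(\mathcal E^J,C_b^{E,1}(\mathbb M))$ is closable in $L^2(\mathbb M^{ac},\Lambda)$: if $u_n\in C_b^{E,1}(\mathbb M)$, $u_n\to0$ in $L^2(\Lambda)$ and $\mathcal E^J(u_n-u_m,u_n-u_m)\to0$ as $n,m\to\infty$, then $\mathcal E^J(u_n,u_n)\to0$. Its closure is a quasi-regular Dirichlet form. Here the domain of the closure consists of the $L^2(\Lambda)$-limits $f$ of $\mathcal E^J$-Cauchy sequences $(u_n)$ in $C_b^{E,1}(\mathbb M)$, and its value at $(f,g)$ is $\lim_n\mathcal E^J(u_n,v_n)$ for any such sequences $(u_n)$ for $f$ and $(v_n)$ for $g$. (2) The same holds with $\mathbb M^{ac}$ and $C_b^{E,1}(\mathbb M)$ replaced by $\mathscr P^{ac}$ and $C_b^{E,1}(\mathscr P)$ throughout. -/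

import Mathlib

open MeasureTheory Filter Topology Set
open scoped ENNReal NNReal

noncomputable section

namespace ExtrinsicJump

/-! ### The extrinsic derivative and the classes `C_b^{E,1}`

`FiniteMeasure M` and `ProbabilityMeasure M` carry Mathlib's topology of weak convergence. -/

section Extrinsic

variable {M : Type*} [TopologicalSpace M] [MeasurableSpace M] [BorelSpace M]

/-- `D μ x` is the right derivative at `ε = 0` of `ε ↦ u (μ + ε δ_x)`, for every finite measure `μ`
and every point `x`. -/
def IsExtrinsicDeriv (u : FiniteMeasure M → ℝ) (D : FiniteMeasure M → M → ℝ) : Prop :=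
  ∀ (μ : FiniteMeasure M) (x : M),
    Tendsto (fun ε : ℝ≥0 => (u (μ + ε • (diracProba x).toFiniteMeasure) - u μ) / (ε : ℝ))
      (𝓝[>] 0) (𝓝 (D μ x))

/-- The probability measure `(1 - ε) μ + ε δ_x`, for `ε ∈ [0, 1]`. -/
def mixDirac (ε : unitInterval) (μ : ProbabilityMeasure M) (x : M) : ProbabilityMeasure M :=
  ⟨ENNReal.ofReal (1 - (ε : ℝ)) • (μ : Measure M) + ENNReal.ofReal (ε : ℝ) • Measure.dirac x, by
    constructor
    have h0 : (0 : ℝ) ≤ 1 - (ε : ℝ) := sub_nonneg.2 ε.2.2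
    simp only [Measure.coe_add, Measure.coe_smul, Pi.add_apply, Pi.smul_apply, measure_univ,
      smul_eq_mul, mul_one]
    rw [← ENNReal.ofReal_add h0 ε.2.1]
    simp⟩

/-- `D μ x` is the right derivative at `ε = 0` of `ε ↦ u ((1 - ε) μ + ε δ_x)`, for every probability
measure `μ` and every point `x`. -/
def IsConvexExtrinsicDeriv (u : ProbabilityMeasure M → ℝ) (D : ProbabilityMeasure M → M → ℝ) :
    Prop :=
  ∀ (μ : ProbabilityMeasure M) (x : M),
    Tendsto (fun ε : unitInterval => (u (mixDirac ε μ x) - u μ) / (ε : ℝ))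
      (𝓝[>] 0) (𝓝 (D μ x))

variable (M) in
/-- The space `C_b^{E,1}(𝕄)`: continuous functions on finite measures with a jointly continuous
extrinsic derivative, the function and the derivative being bounded. -/
def CbE1Finite : Submodule ℝ (FiniteMeasure M → ℝ) where
  carrier := {u | Continuous u ∧ ∃ D : FiniteMeasure M → M → ℝ, IsExtrinsicDeriv u D ∧
    Continuous (fun p : FiniteMeasure M × M => D p.1 p.2) ∧
    ∃ C : ℝ, ∀ μ x, |u μ| + |D μ x| ≤ C}
  add_mem' := by
    rintro u v ⟨hu, D, hD, hDc, C, hC⟩ ⟨hv, D', hD', hDc', C', hC'⟩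
    refine ⟨hu.add hv, fun μ x => D μ x + D' μ x, fun μ x => ?_, hDc.add hDc', C + C',
      fun μ x => ?_⟩
    · refine ((hD μ x).add (hD' μ x)).congr fun ε => ?_
      simp only [Pi.add_apply]
      ring
    · have h1 := hC μ x
      have h2 := hC' μ x
      have h3 := abs_add_le (u μ) (v μ)
      have h4 := abs_add_le (D μ x) (D' μ x)
      simp only [Pi.add_apply]
      linarith
  zero_mem' := ⟨continuous_const, fun _ _ => 0,
    fun μ x => by simp, continuous_const, 0, by simp⟩
  smul_mem' := by
    rintro c u ⟨hu, D, hD, hDc, C, hC⟩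
    refine ⟨hu.const_smul c, fun μ x => c * D μ x, fun μ x => ?_, hDc.const_mul c, |c| * C,
      fun μ x => ?_⟩
    · refine ((hD μ x).const_mul c).congr fun ε => ?_
      simp only [Pi.smul_apply, smul_eq_mul]
      ring
    · simp only [Pi.smul_apply, smul_eq_mul, abs_mul, ← mul_add]
      exact mul_le_mul_of_nonneg_left (hC μ x) (abs_nonneg c)

variable (M) in
/-- The space `C_b^{E,1}(𝒫)`: continuous functions on probability measures with a jointly continuous
convexity extrinsic derivative, the function and the derivative being bounded. -/
def CbE1Prob : Submodule ℝ (ProbabilityMeasure M → ℝ) where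
  carrier := {u | Continuous u ∧ ∃ D : ProbabilityMeasure M → M → ℝ, IsConvexExtrinsicDeriv u D ∧
    Continuous (fun p : ProbabilityMeasure M × M => D p.1 p.2) ∧
    ∃ C : ℝ, ∀ μ x, |u μ| + |D μ x| ≤ C}
  add_mem' := by
    rintro u v ⟨hu, D, hD, hDc, C, hC⟩ ⟨hv, D', hD', hDc', C', hC'⟩
    refine ⟨hu.add hv, fun μ x => D μ x + D' μ x, fun μ x => ?_, hDc.add hDc', C + C',
      fun μ x => ?_⟩
    · refine ((hD μ x).add (hD' μ x)).congr fun ε => ?_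
      simp only [Pi.add_apply]
      ring
    · have h1 := hC μ x
      have h2 := hC' μ x
      have h3 := abs_add_le (u μ) (v μ)
      have h4 := abs_add_le (D μ x) (D' μ x)
      simp only [Pi.add_apply]
      linarith
  zero_mem' := ⟨continuous_const, fun _ _ => 0,
    fun μ x => by simpa using tendsto_const_nhds, continuous_const, 0, by simp⟩
  smul_mem' := by
    rintro c u ⟨hu, D, hD, hDc, C, hC⟩
    refine ⟨hu.const_smul c, fun μ x => c * D μ x, fun μ x => ?_, hDc.const_mul c, |c| * C,
      fun μ x => ?_⟩
    · refine ((hD μ x).const_mul c).congr fun ε => ?_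
      simp only [Pi.smul_apply, smul_eq_mul]
      ring
    · simp only [Pi.smul_apply, smul_eq_mul, abs_mul, ← mul_add]
      exact mul_le_mul_of_nonneg_left (hC μ x) (abs_nonneg c)

end Extrinsic

/-! ### The spaces of absolutely continuous measures, with the total variation distance -/

section ACMeasures

variable {M : Type*} [MeasurableSpace M]

/-- `𝕄^ac`: the finite measures on `M` that are absolutely continuous with respect to `lam`. -/
def ACFinite (lam : Measure M) : Type _ :=
  {μ : Measure M // IsFiniteMeasure μ ∧ μ ≪ lam}

variable {lam : Measure M}

namespace ACFinite

/-- The density `h_μ = dμ / d lam`. -/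
def density (μ : ACFinite lam) (x : M) : ℝ := (μ.1.rnDeriv lam x).toReal

/-- `μ` as an element of the space of all finite measures. -/
def toFin (μ : ACFinite lam) : FiniteMeasure M := ⟨μ.1, μ.2.1⟩

theorem integrable_density (μ : ACFinite lam) : Integrable μ.density lam :=
  haveI := μ.2.1
  Measure.integrable_toReal_rnDeriv

/-- The total variation distance, `∫ |h_μ - h_ν| d lam`. -/
instance instMetricSpace [SigmaFinite lam] : MetricSpace (ACFinite lam) where
  dist μ ν := ∫ x, |μ.density x - ν.density x| ∂lam
  dist_self μ := by simp
  dist_comm μ ν := by simp only [abs_sub_comm]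
  dist_triangle μ ν κ := by
    have h1 := (μ.integrable_density.sub ν.integrable_density).abs
    have h2 := (ν.integrable_density.sub κ.integrable_density).abs
    have h3 := (μ.integrable_density.sub κ.integrable_density).abs
    refine (integral_mono h3 (h1.add h2) fun x => abs_sub_le (μ.density x) _ _).trans_eq ?_
    exact integral_add h1 h2
  eq_of_dist_eq_zero := by
    intro μ ν h
    have := μ.2.1
    have := ν.2.1
    have h1 := (μ.integrable_density.sub ν.integrable_density).abs
    have h2 := (integral_eq_zero_iff_of_nonneg (fun x => abs_nonneg _) h1).1 h
    have h3 : μ.1.rnDeriv lam =ᵐ[lam] ν.1.rnDeriv lam := by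
      filter_upwards [h2, μ.1.rnDeriv_lt_top lam, ν.1.rnDeriv_lt_top lam] with x hx h4 h5
      have h6 : μ.density x = ν.density x := sub_eq_zero.1 (abs_eq_zero.1 hx)
      exact (ENNReal.toReal_eq_toReal_iff' h4.ne h5.ne).1 h6
    apply Subtype.ext
    rw [← Measure.withDensity_rnDeriv_eq _ _ μ.2.2, ← Measure.withDensity_rnDeriv_eq _ _ ν.2.2]
    exact withDensity_congr_ae h3

instance instMeasurableSpace [SigmaFinite lam] : MeasurableSpace (ACFinite lam) :=
  borel (ACFinite lam)

instance instBorelSpace [SigmaFinite lam] : BorelSpace (ACFinite lam) := ⟨rfl⟩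

end ACFinite

/-- `𝒫^ac`: the probability measures on `M` that are absolutely continuous with respect to `lam`,
with the metric and the Borel sets of the subspace of `𝕄^ac`. -/
abbrev ACProb (lam : Measure M) : Type _ := {μ : ACFinite lam // IsProbabilityMeasure μ.1}

/-- `μ` as an element of the space of all probability measures. -/
def ACProb.toProb (μ : ACProb lam) : ProbabilityMeasure M := ⟨μ.1.1, μ.2⟩

/-- The restrictions to `𝕄^ac` of the functions of class `C_b^{E,1}(𝕄)`. -/
def coreFinite [TopologicalSpace M] [BorelSpace M] (lam : Measure M) :
    Submodule ℝ (ACFinite lam → ℝ) :=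
  (CbE1Finite M).map (LinearMap.funLeft ℝ ℝ ACFinite.toFin)

/-- The restrictions to `𝒫^ac` of the functions of class `C_b^{E,1}(𝒫)`. -/
def coreProb [TopologicalSpace M] [BorelSpace M] (lam : Measure M) :
    Submodule ℝ (ACProb lam → ℝ) :=
  (CbE1Prob M).map (LinearMap.funLeft ℝ ℝ ACProb.toProb)

end ACMeasures

/-! ### Dirichlet forms on `L²(E, Λ)`: closability, closure, quasi-regularity -/

section Dirichlet

variable {E : Type*} [MeasurableSpace E]

/-- A bilinear form defined on a linear subspace of `L²(E, Λ)`. -/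
structure L2Form (Λ : Measure E) where
  /-- The domain of the form. -/
  domain : Submodule ℝ (Lp ℝ 2 Λ)
  /-- The form. -/
  form : domain →ₗ[ℝ] domain →ₗ[ℝ] ℝ

namespace L2Form

variable {Λ : Measure E} (𝓔 : L2Form Λ)

/-- `𝓔₁(u, v) = 𝓔(u, v) + ∫ u v dΛ`. -/
def form1 (u v : 𝓔.domain) : ℝ := 𝓔.form u v + ∫ x, (u : Lp ℝ 2 Λ) x * (v : Lp ℝ 2 Λ) x ∂Λ

/-- Symmetric Dirichlet forms on `L²(E, Λ)` for a probability measure `Λ`, with the convention that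
constants belong to the domain. -/
structure IsDirichlet [IsProbabilityMeasure Λ] : Prop where
  dense_domain : Dense (𝓔.domain : Set (Lp ℝ 2 Λ))
  symm : ∀ u v, 𝓔.form u v = 𝓔.form v u
  nonneg : ∀ u, 0 ≤ 𝓔.form u u
  coercive : ∃ K : ℝ, 0 < K ∧ ∀ u v, |𝓔.form1 u v| ≤ K * √(𝓔.form1 u u * 𝓔.form1 v v)
  /-- The domain is complete for the norm `𝓔₁^{1/2}`. -/
  complete : ∀ u : ℕ → 𝓔.domain,
    Tendsto (fun p : ℕ × ℕ => 𝓔.form1 (u p.1 - u p.2) (u p.1 - u p.2)) atTop (𝓝 0) →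
    ∃ v : 𝓔.domain, Tendsto (fun n => 𝓔.form1 (u n - v) (u n - v)) atTop (𝓝 0)
  /-- `u⁺ ∧ 1` belongs to the domain and `𝓔(u⁺ ∧ 1) ≤ 𝓔(u)`. -/
  markov : ∀ u : 𝓔.domain, ∃ w : 𝓔.domain,
    ((w : Lp ℝ 2 Λ) : E → ℝ) =ᵐ[Λ] (fun x => min (max ((u : Lp ℝ 2 Λ) x) 0) 1) ∧
      𝓔.form w w ≤ 𝓔.form u u
  one_mem : Lp.const 2 Λ (1 : ℝ) ∈ 𝓔.domain

variable [TopologicalSpace E]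

/-- The `1`-capacity of an open set (an infimum in `[0, ∞]`, equal to `∞` if no function of the
domain is at least `1` on `O`). -/
def capOpen (O : Set E) : ℝ≥0∞ :=
  ⨅ (u : 𝓔.domain) (_ : ∀ᵐ x ∂Λ, x ∈ O → 1 ≤ (u : Lp ℝ 2 Λ) x), ENNReal.ofReal (𝓔.form1 u u)

/-- The `1`-capacity of an arbitrary set. -/
def cap (A : Set E) : ℝ≥0∞ := ⨅ (O : Set E) (_ : IsOpen O) (_ : A ⊆ O), 𝓔.capOpen O

/-- An `𝓔`-nest. -/
def IsNest (K : ℕ → Set E) : Prop :=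
  (∀ n, IsClosed (K n)) ∧ Tendsto (fun n => 𝓔.cap (K n)ᶜ) atTop (𝓝 0)

/-- Quasi-continuous functions. -/
def QuasiContinuous (f : E → ℝ) : Prop :=
  Measurable f ∧ ∃ K : ℕ → Set E, 𝓔.IsNest K ∧ ∀ n, ContinuousOn f (K n)

/-- Quasi-regularity. A function belongs to the domain if its `Λ`-class does. -/
structure IsQuasiRegular : Prop where
  /-- There is a nest of compact sets. -/
  tight : ∃ K : ℕ → Set E, 𝓔.IsNest K ∧ ∀ n, IsCompact (K n)
  /-- There is an `𝓔₁^{1/2}`-dense subspace of the domain whose elements have quasi-continuous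
  versions. -/
  dense_quasiContinuous : ∃ S : Submodule ℝ 𝓔.domain,
    (∀ v ∈ S, ∃ f : E → ℝ, 𝓔.QuasiContinuous f ∧ f =ᵐ[Λ] (v : Lp ℝ 2 Λ)) ∧
    ∀ u : 𝓔.domain, ∀ ε : ℝ, 0 < ε → ∃ v ∈ S, 𝓔.form1 (u - v) (u - v) < ε
  /-- Outside a set of zero capacity, the points are separated by a sequence of quasi-continuous
  functions of the domain. -/
  separating : ∃ N : Set E, 𝓔.cap N = 0 ∧ ∃ f : ℕ → E → ℝ,
    (∀ n, 𝓔.QuasiContinuous (f n) ∧ ∃ u : 𝓔.domain, f n =ᵐ[Λ] (u : Lp ℝ 2 Λ)) ∧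
    ∀ x ∈ Nᶜ, ∀ y ∈ Nᶜ, x ≠ y → ∃ n, f n x ≠ f n y

end L2Form

/-- `B(u_n - u_m, u_n - u_m) → 0` as `n, m → ∞`. -/
def FormCauchy (B : (E → ℝ) → (E → ℝ) → ℝ) (u : ℕ → E → ℝ) : Prop :=
  Tendsto (fun p : ℕ × ℕ => B (u p.1 - u p.2) (u p.1 - u p.2)) atTop (𝓝 0)

/-- The form `B` on the linear space `𝓒` of functions is closable in `L²(E, Λ)`. -/
def IsClosable (Λ : Measure E) (𝓒 : Submodule ℝ (E → ℝ)) (B : (E → ℝ) → (E → ℝ) → ℝ) : Prop :=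
  ∀ u : ℕ → E → ℝ, (∀ n, u n ∈ 𝓒) → Tendsto (fun n => eLpNorm (u n) 2 Λ) atTop (𝓝 0) →
    FormCauchy B u → Tendsto (fun n => B (u n) (u n)) atTop (𝓝 0)

/-- `u` is a `B`-Cauchy sequence in `𝓒` that converges to `f` in `L²(E, Λ)`. -/
structure IsApprox (Λ : Measure E) (𝓒 : Submodule ℝ (E → ℝ)) (B : (E → ℝ) → (E → ℝ) → ℝ)
    (u : ℕ → E → ℝ) (f : Lp ℝ 2 Λ) : Prop where
  mem : ∀ n, u n ∈ 𝓒
  tendsto : Tendsto (fun n => eLpNorm (fun x => u n x - f x) 2 Λ) atTop (𝓝 0)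
  cauchy : FormCauchy B u

/-- `𝓔` is the closure in `L²(E, Λ)` of the form `B` on `𝓒`: its domain consists of the `L²`-limits
`f` of `B`-Cauchy sequences `u_n` in `𝓒`, and `𝓔(f, g) = lim B(u_n, v_n)` whatever the approximating
sequences `u_n` of `f` and `v_n` of `g`. This determines `𝓔`. -/
structure IsClosure (Λ : Measure E) (𝓒 : Submodule ℝ (E → ℝ)) (B : (E → ℝ) → (E → ℝ) → ℝ)
    (𝓔 : L2Form Λ) : Prop where
  mem_domain_iff : ∀ f : Lp ℝ 2 Λ, f ∈ 𝓔.domain ↔ ∃ u, IsApprox Λ 𝓒 B u f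
  form_eq : ∀ (f g : 𝓔.domain) (u v : ℕ → E → ℝ), IsApprox Λ 𝓒 B u f → IsApprox Λ 𝓒 B v g →
    Tendsto (fun n => B (u n) (v n)) atTop (𝓝 (𝓔.form f g))

/-- The jump form `∫ (u(γ) - u(η)) (v(γ) - v(η)) dJ(γ, η)`. -/
def jumpForm (J : Measure (E × E)) (u v : E → ℝ) : ℝ :=
  ∫ p, (u p.1 - u p.2) * (v p.1 - v p.2) ∂J

end Dirichlet

end ExtrinsicJump

end

open ExtrinsicJump

/-!
The jump form is `⟪Du, Dv⟫` in `L²(J)` for the difference operator `Df(γ, η) = f(γ) - f(η)`. Since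
`J ≪ Λ × Λ`, the operator `D` acts on `Λ`-classes, and passing to almost everywhere convergent
subsequences shows that its graph is closable; the closure of the form is the form of the closed
graph, and the Markov property follows by approximating the absolute value by `C¹` functions.

The functions of the core are bounded and Lipschitz for the total variation distance: two measures
are compared through their common part, the added mass is approximated by finite sums of Dirac
masses, and the extrinsic derivative bounds the increment along each of them; a probability measure
is first normalized. Hence the jump form is finite on the core.

The distance to a fixed measure is a supremum of countably many integrals of bounded continuous
functions, so its arctangent lies in the domain of the closure. Minima of these functions over
finite parts of a dense sequence have bounded energy and tend to zero, which yields a nest of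
compact sets; the arctangents themselves separate points.
-/

noncomputable section

namespace ExtrinsicJump

section Lp

variable {α F : Type*} [MeasurableSpace α] {μ : Measure α} [NormedAddCommGroup F] {p : ℝ≥0∞}

theorem tendsto_eLpNorm_of_dominated (hp : p ≠ ∞) {f : ℕ → α → F} {g : α → ℝ}
    (hf : ∀ n, AEStronglyMeasurable (f n) μ) (hg : MemLp g p μ)
    (bound : ∀ n, ∀ᵐ x ∂μ, ‖f n x‖ ≤ g x) (lim : ∀ᵐ x ∂μ, Tendsto (f · x) atTop (𝓝 0)) :
    Tendsto (fun n => eLpNorm (f n) p μ) atTop (𝓝 0) := by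
  rcases eq_or_ne p 0 with rfl | h0
  · simp
  have hp0 : 0 < p.toReal := ENNReal.toReal_pos h0 hp
  have key : Tendsto (fun n => ∫⁻ x, ‖f n x‖ₑ ^ p.toReal ∂μ) atTop (𝓝 0) := by
    rw [← lintegral_zero (μ := μ)]
    refine tendsto_lintegral_of_dominated_convergence' (fun x => ‖g x‖ₑ ^ p.toReal)
      (fun n => (hf n).enorm.pow_const _) (fun n => ?_)
      (lintegral_rpow_enorm_lt_top_of_eLpNorm_lt_top h0 hp hg.2).ne ?_
    · filter_upwards [bound n] with x hx
      gcongr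
      exact enorm_le_iff_norm_le.2 (hx.trans (Real.le_norm_self _))
    · filter_upwards [lim] with x hx
      simpa [hp0] using hx.enorm.ennrpow_const p.toReal
  simp only [eLpNorm_eq_lintegral_rpow_enorm_toReal h0 hp]
  simpa [hp0] using key.ennrpow_const (1 / p.toReal)

theorem tendsto_eLpNorm_of_norm_le_add (hp1 : 1 ≤ p) (hp : p ≠ ∞) {f d : ℕ → α → F} {g : α → ℝ}
    (hf : ∀ n, AEStronglyMeasurable (f n) μ) (hd : ∀ n, AEStronglyMeasurable (d n) μ)
    (hg : MemLp g p μ) (bound : ∀ n x, ‖f n x‖ ≤ ‖d n x‖ + ‖g x‖)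
    (hd0 : Tendsto (fun n => eLpNorm (d n) p μ) atTop (𝓝 0))
    (lim : ∀ᵐ x ∂μ, Tendsto (f · x) atTop (𝓝 0)) :
    Tendsto (fun n => eLpNorm (f n) p μ) atTop (𝓝 0) := by
  let r (n : ℕ) (x : α) : ℝ := min ‖f n x‖ ‖g x‖
  have hr (n : ℕ) : AEStronglyMeasurable (r n) μ := (hf n).norm.inf hg.1.norm
  have hr0 : Tendsto (fun n => eLpNorm (r n) p μ) atTop (𝓝 0) := by
    refine tendsto_eLpNorm_of_dominated hp hr hg.norm (fun n => .of_forall fun x => ?_) ?_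
    · rw [Real.norm_of_nonneg (by positivity)]
      exact min_le_right _ _
    · filter_upwards [lim] with x hx
      simpa [r] using hx.norm.min (tendsto_const_nhds (x := ‖g x‖))
  refine tendsto_of_tendsto_of_tendsto_of_le_of_le tendsto_const_nhds
    (by simpa using hr0.add hd0) (fun _ => zero_le) fun n => ?_
  calc eLpNorm (f n) p μ ≤ eLpNorm (fun x => r n x + ‖d n x‖) p μ :=
        eLpNorm_mono_real fun x => by
          rcases le_total ‖f n x‖ ‖g x‖ with h | h
          · exact (min_eq_left h).ge.trans (le_add_of_nonneg_right (norm_nonneg _))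
          · simpa only [r, min_eq_right h, add_comm] using bound n x
    _ ≤ eLpNorm (r n) p μ + eLpNorm (fun x => ‖d n x‖) p μ :=
        eLpNorm_add_le (hr n) (hd n).norm hp1
    _ = eLpNorm (r n) p μ + eLpNorm (d n) p μ := by rw [eLpNorm_norm]

theorem exists_subseq_tendsto_ae [Fact (1 ≤ p)] {f : ℕ → Lp F p μ} {g : Lp F p μ}
    (h : Tendsto f atTop (𝓝 g)) :
    ∃ ns : ℕ → ℕ, StrictMono ns ∧ ∀ᵐ x ∂μ, Tendsto (fun i => f (ns i) x) atTop (𝓝 (g x)) :=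
  (tendstoInMeasure_of_tendsto_Lp h).exists_seq_tendsto_ae

theorem tendsto_toLp_of_eLpNorm [Fact (1 ≤ p)] {q : ℕ → Lp F p μ} {f : ℕ → α → F} {g : α → F}
    (hg : MemLp g p μ) (hq : ∀ n, q n =ᵐ[μ] f n)
    (h : Tendsto (fun n => eLpNorm (f n - g) p μ) atTop (𝓝 0)) :
    Tendsto q atTop (𝓝 (hg.toLp g)) := by
  rw [Lp.tendsto_Lp_iff_tendsto_eLpNorm]
  exact h.congr fun n => eLpNorm_congr_ae ((hq n).symm.sub .rfl)

end Lp

theorem cauchySeq_iff_tendsto_norm_sub_sq {F : Type*} [SeminormedAddCommGroup F] {u : ℕ → F} :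
    CauchySeq u ↔ Tendsto (fun p : ℕ × ℕ => ‖u p.1 - u p.2‖ ^ 2) atTop (𝓝 0) := by
  simp only [cauchySeq_iff_tendsto_dist_atTop_0, dist_eq_norm]
  refine ⟨fun h => by simpa using h.pow 2, fun h => ?_⟩
  simpa only [Real.sqrt_sq (norm_nonneg _), Real.sqrt_zero] using h.sqrt

section Graph

variable {E : Type*}

/-- The difference `(γ, η) ↦ f(γ) - f(η)`: the jump form is `⟪jumpDiff u, jumpDiff v⟫` in
`L²(J)`. -/
def jumpDiff : (E → ℝ) →ₗ[ℝ] (E × E → ℝ) :=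
  LinearMap.funLeft ℝ ℝ Prod.fst - LinearMap.funLeft ℝ ℝ Prod.snd

@[simp]
theorem jumpDiff_apply (f : E → ℝ) (p : E × E) : jumpDiff f p = f p.1 - f p.2 := rfl

theorem abs_jumpDiff_abs_le (f : E → ℝ) (p : E × E) : |jumpDiff |f| p| ≤ |jumpDiff f p| :=
  abs_abs_sub_abs_le_abs_sub _ _

variable [MeasurableSpace E] {Λ : Measure E} {J : Measure (E × E)} {𝓒 : Submodule ℝ (E → ℝ)}

theorem ae_fst_and_snd [SFinite Λ] (hJ : J ≪ Λ.prod Λ) {P : E → Prop} (h : ∀ᵐ x ∂Λ, P x) :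
    ∀ᵐ p ∂J, P p.1 ∧ P p.2 :=
  hJ.ae_le ((Measure.quasiMeasurePreserving_fst.ae h).and
    (Measure.quasiMeasurePreserving_snd.ae h))

theorem jumpDiff_congr_ae [SFinite Λ] (hJ : J ≪ Λ.prod Λ) {f g : E → ℝ} (h : f =ᵐ[Λ] g) :
    jumpDiff f =ᵐ[J] jumpDiff g := by
  filter_upwards [ae_fst_and_snd hJ h] with p hp
  rw [jumpDiff_apply, jumpDiff_apply, hp.1, hp.2]

theorem aestronglyMeasurable_jumpDiff [SFinite Λ] (hJ : J ≪ Λ.prod Λ) {f : E → ℝ}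
    (hf : AEStronglyMeasurable f Λ) : AEStronglyMeasurable (jumpDiff f) J :=
  .congr ((hf.stronglyMeasurable_mk.comp_measurable measurable_fst).sub
    (hf.stronglyMeasurable_mk.comp_measurable measurable_snd)).aestronglyMeasurable
    (jumpDiff_congr_ae hJ hf.ae_eq_mk.symm)

/-- A space of functions is of finite energy if the jump form and the `L²(Λ)`-norm are finite
on it. -/
def FiniteEnergy (Λ : Measure E) (J : Measure (E × E)) (𝓒 : Submodule ℝ (E → ℝ)) : Prop :=
  ∀ u ∈ 𝓒, MemLp u 2 Λ ∧ MemLp (jumpDiff u) 2 J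

variable (Λ J 𝓒) in
/-- The graph in `L²(Λ) × L²(J)` of `jumpDiff` on the core. -/
def coreGraph : Submodule ℝ (Lp ℝ 2 Λ × Lp ℝ 2 J) where
  carrier := {q | ∃ u ∈ 𝓒, q.1 =ᵐ[Λ] u ∧ q.2 =ᵐ[J] jumpDiff u}
  add_mem' := by
    rintro q r ⟨u, hu, hu1, hu2⟩ ⟨v, hv, hv1, hv2⟩
    refine ⟨u + v, 𝓒.add_mem hu hv, (Lp.coeFn_add _ _).trans (hu1.add hv1), ?_⟩
    rw [map_add]
    exact (Lp.coeFn_add _ _).trans (hu2.add hv2)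
  zero_mem' := by
    refine ⟨0, 𝓒.zero_mem, Lp.coeFn_zero _ _ _, ?_⟩
    rw [map_zero]
    exact Lp.coeFn_zero _ _ _
  smul_mem' := by
    rintro c q ⟨u, hu, hu1, hu2⟩
    refine ⟨c • u, 𝓒.smul_mem c hu, (Lp.coeFn_smul _ _).trans (hu1.const_smul c), ?_⟩
    rw [map_smul]
    exact (Lp.coeFn_smul _ _).trans (hu2.const_smul c)

variable (Λ J 𝓒) in
/-- The closure of the graph of `jumpDiff` on the core; it is again a graph if `J ≪ Λ × Λ`, and
this is the closability of the jump form. -/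
def closedGraph : Submodule ℝ (Lp ℝ 2 Λ × Lp ℝ 2 J) := (coreGraph Λ J 𝓒).topologicalClosure

theorem isClosed_closedGraph : IsClosed (closedGraph Λ J 𝓒 : Set (Lp ℝ 2 Λ × Lp ℝ 2 J)) :=
  Submodule.isClosed_topologicalClosure _

theorem isClosed_setOf_snd_ae_eq_jumpDiff [SFinite Λ] (hJ : J ≪ Λ.prod Λ) :
    IsClosed {q : Lp ℝ 2 Λ × Lp ℝ 2 J | q.2 =ᵐ[J] jumpDiff q.1} := by
  refine IsSeqClosed.isClosed fun q r hq hr => ?_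
  obtain ⟨ns, hns, h1⟩ := exists_subseq_tendsto_ae ((continuous_fst.tendsto r).comp hr)
  obtain ⟨ms, hms, h2⟩ := exists_subseq_tendsto_ae
    (((continuous_snd.tendsto r).comp hr).comp hns.tendsto_atTop)
  have hqn : ∀ᵐ p ∂J, ∀ n, (q n).2 p = jumpDiff (q n).1 p := ae_all_iff.2 hq
  filter_upwards [h2, hqn, ae_fst_and_snd hJ h1] with p hp2 hpq hp1
  refine tendsto_nhds_unique hp2 (Tendsto.congr (fun n => (hpq _).symm) ?_)
  exact (hp1.1.comp hms.tendsto_atTop).sub (hp1.2.comp hms.tendsto_atTop)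

theorem snd_ae_eq_jumpDiff [SFinite Λ] (hJ : J ≪ Λ.prod Λ) {q : Lp ℝ 2 Λ × Lp ℝ 2 J}
    (hq : q ∈ closedGraph Λ J 𝓒) : q.2 =ᵐ[J] jumpDiff q.1 := by
  refine closure_minimal ?_ (isClosed_setOf_snd_ae_eq_jumpDiff hJ) hq
  rintro q ⟨u, -, h1, h2⟩
  exact h2.trans (jumpDiff_congr_ae hJ h1.symm)

theorem snd_eq_zero_of_mem_closedGraph [SFinite Λ] (hJ : J ≪ Λ.prod Λ) (q : Lp ℝ 2 Λ × Lp ℝ 2 J)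
    (hq : q ∈ closedGraph Λ J 𝓒) (h0 : q.1 = 0) : q.2 = 0 := by
  have h1 : q.2 =ᵐ[J] jumpDiff 0 :=
    (snd_ae_eq_jumpDiff hJ hq).trans (jumpDiff_congr_ae hJ (h0 ▸ Lp.coeFn_zero ℝ 2 Λ))
  rw [map_zero] at h1
  exact Lp.ext (h1.trans (Lp.coeFn_zero ℝ 2 J).symm)

/-- The point of `L²(Λ) × L²(J)` given by a function and its difference. -/
def graphPoint (f : E → ℝ) (h : MemLp f 2 Λ ∧ MemLp (jumpDiff f) 2 J) : Lp ℝ 2 Λ × Lp ℝ 2 J :=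
  (h.1.toLp f, h.2.toLp (jumpDiff f))

theorem graphPoint_mem {u : E → ℝ} (hu : u ∈ 𝓒) (h : MemLp u 2 Λ ∧ MemLp (jumpDiff u) 2 J) :
    graphPoint u h ∈ closedGraph Λ J 𝓒 :=
  subset_closure ⟨u, hu, h.1.coeFn_toLp, h.2.coeFn_toLp⟩

theorem exists_tendsto_graphPoint (h : FiniteEnergy Λ J 𝓒) {q : Lp ℝ 2 Λ × Lp ℝ 2 J}
    (hq : q ∈ closedGraph Λ J 𝓒) : ∃ u : ℕ → E → ℝ, ∃ hu : ∀ n, u n ∈ 𝓒,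
      Tendsto (fun n => graphPoint (u n) (h _ (hu n))) atTop (𝓝 q) := by
  obtain ⟨r, hr, hrq⟩ := mem_closure_iff_seq_limit.1 hq
  choose u hu h1 h2 using hr
  refine ⟨u, hu, hrq.congr fun n => Prod.ext ?_ ?_⟩
  · exact Lp.ext ((h1 n).trans (h _ (hu n)).1.coeFn_toLp.symm)
  · exact Lp.ext ((h2 n).trans (h _ (hu n)).2.coeFn_toLp.symm)

theorem jumpForm_eq_inner {u v : E → ℝ} (hu : MemLp (jumpDiff u) 2 J)
    (hv : MemLp (jumpDiff v) 2 J) :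
    jumpForm J u v = inner ℝ (hu.toLp (jumpDiff u)) (hv.toLp (jumpDiff v)) := by
  rw [L2.inner_def]
  refine integral_congr_ae ?_
  filter_upwards [hu.coeFn_toLp, hv.coeFn_toLp] with p h1 h2
  simp [h1, h2, mul_comm]

theorem jumpForm_sub_self {u v : E → ℝ} (hu : MemLp (jumpDiff u) 2 J)
    (hv : MemLp (jumpDiff v) 2 J) :
    jumpForm J (u - v) (u - v) = ‖hu.toLp (jumpDiff u) - hv.toLp (jumpDiff v)‖ ^ 2 := by
  have h : MemLp (jumpDiff (u - v)) 2 J := by rw [map_sub]; exact hu.sub hv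
  rw [jumpForm_eq_inner h h, real_inner_self_eq_norm_sq, ← MemLp.toLp_sub]
  congr 2
  exact MemLp.toLp_congr _ _ (by rw [map_sub])

theorem formCauchy_iff_cauchySeq (h : FiniteEnergy Λ J 𝓒) {u : ℕ → E → ℝ} (hu : ∀ n, u n ∈ 𝓒) :
    FormCauchy (jumpForm J) u ↔
      CauchySeq fun n => (h (u n) (hu n)).2.toLp (jumpDiff (u n)) := by
  rw [FormCauchy, cauchySeq_iff_tendsto_norm_sub_sq]
  simp only [fun p : ℕ × ℕ => jumpForm_sub_self (h _ (hu p.1)).2 (h _ (hu p.2)).2]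

theorem isApprox_iff (h : FiniteEnergy Λ J 𝓒) {u : ℕ → E → ℝ} {f : Lp ℝ 2 Λ} :
    IsApprox Λ 𝓒 (jumpForm J) u f ↔ ∃ hu : ∀ n, u n ∈ 𝓒, ∃ g, (f, g) ∈ closedGraph Λ J 𝓒 ∧
      Tendsto (fun n => graphPoint (u n) (h _ (hu n))) atTop (𝓝 (f, g)) := by
  have key (hu : ∀ n, u n ∈ 𝓒) :
      Tendsto (fun n => eLpNorm (fun x => u n x - f x) 2 Λ) atTop (𝓝 0) ↔
      Tendsto (fun n => (h (u n) (hu n)).1.toLp (u n)) atTop (𝓝 f) := by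
    rw [← Lp.toLp_coeFn f (Lp.memLp f),
      Lp.tendsto_Lp_iff_tendsto_eLpNorm'' _ fun n => (h _ (hu n)).1]
    simp only [Lp.toLp_coeFn]
    rfl
  constructor
  · rintro ⟨hu, h1, h2⟩
    obtain ⟨g, hg⟩ := cauchySeq_tendsto_of_complete ((formCauchy_iff_cauchySeq h hu).1 h2)
    have hfg := ((key hu).1 h1).prodMk_nhds hg
    exact ⟨hu, g, isClosed_closedGraph.mem_of_tendsto hfg
      (.of_forall fun n => graphPoint_mem (hu n) (h _ (hu n))), hfg⟩
  · rintro ⟨hu, g, -, h2⟩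
    exact ⟨hu, (key hu).2 ((continuous_fst.tendsto _).comp h2), (formCauchy_iff_cauchySeq h hu).2
      ((continuous_snd.tendsto _).comp h2).cauchySeq⟩

theorem isClosable_jumpForm [SFinite Λ] (hJ : J ≪ Λ.prod Λ) (h : FiniteEnergy Λ J 𝓒) :
    IsClosable Λ 𝓒 (jumpForm J) := by
  intro u hu hu0 hc
  have h0 : IsApprox Λ 𝓒 (jumpForm J) u 0 := by
    refine ⟨hu, hu0.congr fun n => eLpNorm_congr_ae ?_, hc⟩
    filter_upwards [Lp.coeFn_zero ℝ 2 Λ] with x hx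
    rw [hx, Pi.zero_apply, sub_zero]
  obtain ⟨_, g, hg, hlim⟩ := (isApprox_iff h).1 h0
  have hg0 : g = 0 := snd_eq_zero_of_mem_closedGraph hJ _ hg rfl
  simp only [fun n => jumpForm_eq_inner (h _ (hu n)).2 (h _ (hu n)).2, real_inner_self_eq_norm_sq]
  have hsq := ((continuous_snd.tendsto _).comp hlim).norm.pow 2
  rwa [hg0, norm_zero, zero_pow two_ne_zero] at hsq

end Graph

section ClosureForm

variable {E : Type*} [MeasurableSpace E]

/-- The closure of the jump form: `(f, g) ↦ ⟪Df, Dg⟫`, where `D` is the operator with graph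
`closedGraph Λ J 𝓒`. -/
def closureForm (Λ : Measure E) (J : Measure (E × E)) (𝓒 : Submodule ℝ (E → ℝ)) : L2Form Λ where
  domain := (closedGraph Λ J 𝓒).toLinearPMap.domain
  form := (innerₗ (Lp ℝ 2 J)).compl₁₂ (closedGraph Λ J 𝓒).toLinearPMap.toFun
    (closedGraph Λ J 𝓒).toLinearPMap.toFun

/-- The operator `f ↦ jumpDiff f` from the domain of the closure to `L²(J)`. -/
def jumpGrad (Λ : Measure E) (J : Measure (E × E)) (𝓒 : Submodule ℝ (E → ℝ)) :
    (closureForm Λ J 𝓒).domain →ₗ[ℝ] Lp ℝ 2 J :=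
  (closedGraph Λ J 𝓒).toLinearPMap.toFun

variable {Λ : Measure E} {J : Measure (E × E)} {𝓒 : Submodule ℝ (E → ℝ)}

theorem closureForm_form (f g : (closureForm Λ J 𝓒).domain) :
    (closureForm Λ J 𝓒).form f g = inner ℝ (jumpGrad Λ J 𝓒 f) (jumpGrad Λ J 𝓒 g) := rfl

theorem closureForm_form1 (f g : (closureForm Λ J 𝓒).domain) :
    (closureForm Λ J 𝓒).form1 f g =
      inner ℝ (jumpGrad Λ J 𝓒 f) (jumpGrad Λ J 𝓒 g) + inner ℝ (f : Lp ℝ 2 Λ) g := by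
  simp only [L2Form.form1, closureForm_form, L2.inner_def (𝕜 := ℝ) (f : Lp ℝ 2 Λ),
    RCLike.inner_apply, conj_trivial, mul_comm]

theorem closureForm_form1_self (f : (closureForm Λ J 𝓒).domain) :
    (closureForm Λ J 𝓒).form1 f f = ‖jumpGrad Λ J 𝓒 f‖ ^ 2 + ‖(f : Lp ℝ 2 Λ)‖ ^ 2 := by
  rw [closureForm_form1, real_inner_self_eq_norm_sq, real_inner_self_eq_norm_sq]

theorem mem_closureForm_domain {f : Lp ℝ 2 Λ} :
    f ∈ (closureForm Λ J 𝓒).domain ↔ ∃ g, (f, g) ∈ closedGraph Λ J 𝓒 := by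
  change f ∈ (closedGraph Λ J 𝓒).toLinearPMap.domain ↔ _
  simp [Submodule.toLinearPMap_domain]

theorem jumpGrad_mem [SFinite Λ] (hJ : J ≪ Λ.prod Λ) (f : (closureForm Λ J 𝓒).domain) :
    ((f : Lp ℝ 2 Λ), jumpGrad Λ J 𝓒 f) ∈ closedGraph Λ J 𝓒 :=
  Submodule.mem_graph_toLinearPMap (snd_eq_zero_of_mem_closedGraph hJ) f

theorem jumpGrad_eq [SFinite Λ] (hJ : J ≪ Λ.prod Λ) (f : (closureForm Λ J 𝓒).domain)
    {g : Lp ℝ 2 J} (h : ((f : Lp ℝ 2 Λ), g) ∈ closedGraph Λ J 𝓒) : jumpGrad Λ J 𝓒 f = g :=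
  sub_eq_zero.1 (snd_eq_zero_of_mem_closedGraph hJ _ (sub_mem (jumpGrad_mem hJ f) h) (by simp))

theorem jumpGrad_ae_eq [SFinite Λ] (hJ : J ≪ Λ.prod Λ) {f : (closureForm Λ J 𝓒).domain} {g : E → ℝ}
    (hfg : (f : Lp ℝ 2 Λ) =ᵐ[Λ] g) : jumpGrad Λ J 𝓒 f =ᵐ[J] jumpDiff g :=
  (snd_ae_eq_jumpDiff hJ (jumpGrad_mem hJ f)).trans (jumpDiff_congr_ae hJ hfg)

theorem isClosure_closureForm [SFinite Λ] (hJ : J ≪ Λ.prod Λ) (h : FiniteEnergy Λ J 𝓒) :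
    IsClosure Λ 𝓒 (jumpForm J) (closureForm Λ J 𝓒) where
  mem_domain_iff f := by
    rw [mem_closureForm_domain]
    constructor
    · rintro ⟨g, hg⟩
      obtain ⟨u, hu, hlim⟩ := exists_tendsto_graphPoint h hg
      exact ⟨u, (isApprox_iff h).2 ⟨hu, g, hg, hlim⟩⟩
    · rintro ⟨u, hu⟩
      obtain ⟨-, g, hg, -⟩ := (isApprox_iff h).1 hu
      exact ⟨g, hg⟩
  form_eq f g u v hu hv := by
    obtain ⟨hu, f', hf, hf'⟩ := (isApprox_iff h).1 hu
    obtain ⟨hv, g', hg, hg'⟩ := (isApprox_iff h).1 hv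
    rw [closureForm_form, jumpGrad_eq hJ f hf, jumpGrad_eq hJ g hg]
    simp only [fun n => jumpForm_eq_inner (h _ (hu n)).2 (h _ (hv n)).2]
    exact ((continuous_snd.tendsto _).comp hf').inner ((continuous_snd.tendsto _).comp hg')

theorem closureForm_complete [SFinite Λ] (hJ : J ≪ Λ.prod Λ) (u : ℕ → (closureForm Λ J 𝓒).domain)
    (hu : Tendsto (fun p : ℕ × ℕ => (closureForm Λ J 𝓒).form1 (u p.1 - u p.2) (u p.1 - u p.2))
      atTop (𝓝 0)) :
    ∃ v : (closureForm Λ J 𝓒).domain,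
      Tendsto (fun n => (closureForm Λ J 𝓒).form1 (u n - v) (u n - v)) atTop (𝓝 0) := by
  simp only [closureForm_form1_self, map_sub, Submodule.coe_sub] at hu ⊢
  have hgrad : CauchySeq fun n => jumpGrad Λ J 𝓒 (u n) :=
    cauchySeq_iff_tendsto_norm_sub_sq.2 (squeeze_zero (fun _ => by positivity)
      (fun _ => le_add_of_nonneg_right (by positivity)) hu)
  have hval : CauchySeq fun n => (u n : Lp ℝ 2 Λ) :=
    cauchySeq_iff_tendsto_norm_sub_sq.2 (squeeze_zero (fun _ => by positivity)
      (fun _ => le_add_of_nonneg_left (by positivity)) hu)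
  obtain ⟨g, hg⟩ := cauchySeq_tendsto_of_complete hgrad
  obtain ⟨f, hf⟩ := cauchySeq_tendsto_of_complete hval
  have hfg : (f, g) ∈ closedGraph Λ J 𝓒 := isClosed_closedGraph.mem_of_tendsto
    (hf.prodMk_nhds hg) (.of_forall fun n => jumpGrad_mem hJ (u n))
  refine ⟨⟨f, mem_closureForm_domain.2 ⟨g, hfg⟩⟩, ?_⟩
  rw [jumpGrad_eq hJ _ hfg]
  simpa using ((tendsto_iff_norm_sub_tendsto_zero.1 hg).pow 2).add
    ((tendsto_iff_norm_sub_tendsto_zero.1 hf).pow 2)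

theorem abs_closureForm_form1_le (u v : (closureForm Λ J 𝓒).domain) :
    |(closureForm Λ J 𝓒).form1 u v| ≤
      √((closureForm Λ J 𝓒).form1 u u * (closureForm Λ J 𝓒).form1 v v) := by
  rw [closureForm_form1_self, closureForm_form1_self, closureForm_form1]
  refine Real.abs_le_sqrt ?_
  set Du := jumpGrad Λ J 𝓒 u
  set Dv := jumpGrad Λ J 𝓒 v
  have hinner : |inner ℝ Du Dv + inner ℝ (u : Lp ℝ 2 Λ) v| ≤
      ‖Du‖ * ‖Dv‖ + ‖(u : Lp ℝ 2 Λ)‖ * ‖(v : Lp ℝ 2 Λ)‖ :=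
    (abs_add_le _ _).trans (add_le_add (abs_real_inner_le_norm _ _) (abs_real_inner_le_norm _ _))
  calc (inner ℝ Du Dv + inner ℝ (u : Lp ℝ 2 Λ) v) ^ 2
      ≤ (‖Du‖ * ‖Dv‖ + ‖(u : Lp ℝ 2 Λ)‖ * ‖(v : Lp ℝ 2 Λ)‖) ^ 2 :=
        sq_le_sq' (abs_le.1 hinner).1 (abs_le.1 hinner).2
    _ ≤ (‖Du‖ ^ 2 + ‖(u : Lp ℝ 2 Λ)‖ ^ 2) * (‖Dv‖ ^ 2 + ‖(v : Lp ℝ 2 Λ)‖ ^ 2) := by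
        nlinarith [sq_nonneg (‖Du‖ * ‖(v : Lp ℝ 2 Λ)‖ - ‖Dv‖ * ‖(u : Lp ℝ 2 Λ)‖)]

end ClosureForm

section StableComp

variable {E : Type*} {𝓒 : Submodule ℝ (E → ℝ)}

variable (𝓒) in
/-- `𝓒` is stable under composition with functions of class `C¹`. -/
def StableComp : Prop := ∀ u ∈ 𝓒, ∀ φ : ℝ → ℝ, ContDiff ℝ 1 φ → (fun x => φ (u x)) ∈ 𝓒

theorem StableComp.const_mem (hC : StableComp 𝓒) (c : ℝ) : (fun _ => c) ∈ 𝓒 :=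
  hC 0 𝓒.zero_mem (fun _ => c) contDiff_const

theorem StableComp.mul_mem (hC : StableComp 𝓒) {u v : E → ℝ} (hu : u ∈ 𝓒) (hv : v ∈ 𝓒) :
    u * v ∈ 𝓒 := by
  have hsq (w) (hw : w ∈ 𝓒) : (fun x => w x ^ 2) ∈ 𝓒 :=
    hC w hw (fun s => s ^ 2) (contDiff_id.pow 2)
  have polarization : u * v = (1 / 2 : ℝ) •
      ((fun x => (u + v) x ^ 2) - (fun x => u x ^ 2) - fun x => v x ^ 2) := by
    ext x
    simp only [Pi.mul_apply, Pi.smul_apply, Pi.sub_apply, Pi.add_apply, smul_eq_mul]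
    ring
  rw [polarization]
  exact 𝓒.smul_mem _ (𝓒.sub_mem (𝓒.sub_mem (hsq _ (𝓒.add_mem hu hv)) (hsq u hu)) (hsq v hv))

end StableComp

section FormDomain

variable {E : Type*} [MeasurableSpace E] {Λ : Measure E} {J : Measure (E × E)}
  {𝓒 : Submodule ℝ (E → ℝ)}

variable (Λ J 𝓒) in
/-- The functions whose `Λ`-class belongs to the domain of the closure. -/
def formDomain : Submodule ℝ (E → ℝ) where
  carrier := {f | ∃ w : (closureForm Λ J 𝓒).domain, (w : Lp ℝ 2 Λ) =ᵐ[Λ] f}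
  add_mem' := by
    rintro f g ⟨w, hw⟩ ⟨z, hz⟩
    exact ⟨w + z, (Lp.coeFn_add _ _).trans (hw.add hz)⟩
  zero_mem' := ⟨0, Lp.coeFn_zero _ _ _⟩
  smul_mem' := by
    rintro c f ⟨w, hw⟩
    exact ⟨c • w, (Lp.coeFn_smul _ _).trans (hw.const_smul c)⟩

theorem mem_formDomain_of_mem_core (h : FiniteEnergy Λ J 𝓒) {u : E → ℝ} (hu : u ∈ 𝓒) :
    u ∈ formDomain Λ J 𝓒 :=
  ⟨⟨_, mem_closureForm_domain.2 ⟨_, graphPoint_mem hu (h u hu)⟩⟩, (h u hu).1.coeFn_toLp⟩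

theorem memLp_of_mem_formDomain {f : E → ℝ} (hf : f ∈ formDomain Λ J 𝓒) : MemLp f 2 Λ := by
  obtain ⟨w, hw⟩ := hf
  exact (memLp_congr_ae hw).1 (Lp.memLp _)

section SFinite

variable [SFinite Λ]

theorem memLp_jumpDiff_of_mem_formDomain (hJ : J ≪ Λ.prod Λ) {f : E → ℝ}
    (hf : f ∈ formDomain Λ J 𝓒) : MemLp (jumpDiff f) 2 J := by
  obtain ⟨w, hw⟩ := hf
  exact (memLp_congr_ae (jumpGrad_ae_eq hJ hw)).1 (Lp.memLp _)

theorem mem_formDomain_of_tendsto (hJ : J ≪ Λ.prod Λ) {F : ℕ → E → ℝ} {f : E → ℝ}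
    (hF : ∀ n, F n ∈ formDomain Λ J 𝓒) (hf : MemLp f 2 Λ) (hf' : MemLp (jumpDiff f) 2 J)
    (hlim : Tendsto (fun n => eLpNorm (F n - f) 2 Λ) atTop (𝓝 0))
    (hlim' : Tendsto (fun n => eLpNorm (jumpDiff (F n) - jumpDiff f) 2 J) atTop (𝓝 0)) :
    f ∈ formDomain Λ J 𝓒 := by
  choose w hw using hF
  have hmem : (hf.toLp f, hf'.toLp (jumpDiff f)) ∈ closedGraph Λ J 𝓒 :=
    isClosed_closedGraph.mem_of_tendsto ((tendsto_toLp_of_eLpNorm hf hw hlim).prodMk_nhds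
      (tendsto_toLp_of_eLpNorm hf' (fun n => jumpGrad_ae_eq hJ (hw n)) hlim'))
      (.of_forall fun n => jumpGrad_mem hJ (w n))
  exact ⟨⟨_, mem_closureForm_domain.2 ⟨_, hmem⟩⟩, hf.coeFn_toLp⟩

theorem exists_seq_core_tendsto (hJ : J ≪ Λ.prod Λ) (h : FiniteEnergy Λ J 𝓒) {f : E → ℝ}
    (hf : f ∈ formDomain Λ J 𝓒) : ∃ u : ℕ → E → ℝ, (∀ n, u n ∈ 𝓒) ∧
      Tendsto (fun n => eLpNorm (u n - f) 2 Λ) atTop (𝓝 0) ∧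
      Tendsto (fun n => eLpNorm (jumpDiff (u n) - jumpDiff f) 2 J) atTop (𝓝 0) ∧
      ∀ᵐ x ∂Λ, Tendsto (fun n => u n x) atTop (𝓝 (f x)) := by
  obtain ⟨w, hw⟩ := hf
  obtain ⟨u, hu, hlim⟩ := exists_tendsto_graphPoint h (jumpGrad_mem hJ w)
  have hval := (continuous_fst.tendsto _).comp hlim
  have hgrad := (continuous_snd.tendsto _).comp hlim
  obtain ⟨ns, hns, hae⟩ := exists_subseq_tendsto_ae hval
  refine ⟨fun n => u (ns n), fun n => hu _, ?_, ?_, ?_⟩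
  · refine (((Lp.tendsto_Lp_iff_tendsto_eLpNorm' _ _).1 hval).comp hns.tendsto_atTop).congr
      fun n => eLpNorm_congr_ae ?_
    exact (h _ (hu _)).1.coeFn_toLp.sub hw
  · refine (((Lp.tendsto_Lp_iff_tendsto_eLpNorm' _ _).1 hgrad).comp hns.tendsto_atTop).congr
      fun n => eLpNorm_congr_ae ?_
    exact (h _ (hu _)).2.coeFn_toLp.sub (jumpGrad_ae_eq hJ hw)
  · filter_upwards [hae, hw, ae_all_iff.2 fun n => (h _ (hu n)).1.coeFn_toLp] with x hx hwx hux
    rw [hwx] at hx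
    exact hx.congr fun i => hux _

theorem memLp_jumpDiff_abs (hJ : J ≪ Λ.prod Λ) {f : E → ℝ} (hf : MemLp f 2 Λ)
    (hf' : MemLp (jumpDiff f) 2 J) : MemLp (jumpDiff |f|) 2 J :=
  hf'.mono (aestronglyMeasurable_jumpDiff hJ hf.abs.1) (.of_forall (abs_jumpDiff_abs_le f))

end SFinite

theorem abs_sqrt_sq_add_sq_sub_le (a b c d : ℝ) :
    |√(a ^ 2 + b ^ 2) - √(c ^ 2 + d ^ 2)| ≤ √((a - c) ^ 2 + (b - d) ^ 2) := by
  simpa [Complex.norm_eq_sqrt_sq_add_sq] using abs_norm_sub_norm_le (⟨a, b⟩ : ℂ) ⟨c, d⟩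

variable [IsFiniteMeasure Λ]

theorem abs_mem_formDomain_of_mem_core (hJ : J ≪ Λ.prod Λ) (h : FiniteEnergy Λ J 𝓒)
    (hC : StableComp 𝓒) {u : E → ℝ} (hu : u ∈ 𝓒) : |u| ∈ formDomain Λ J 𝓒 := by
  let d (n : ℕ) : ℝ := 1 / (n + 1)
  let w (n : ℕ) (x : E) : ℝ := √(u x ^ 2 + d n ^ 2)
  have hd0 (n) : 0 < d n := Nat.one_div_pos_of_nat
  have hw (n) : w n ∈ 𝓒 := hC _ hu (fun s => √(s ^ 2 + d n ^ 2)) <|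
    ContDiff.sqrt (by fun_prop) fun s => (add_pos_of_nonneg_of_pos (sq_nonneg s)
      (pow_pos (hd0 n) 2)).ne'
  have hwu (n x) : |w n x - (|u x|)| ≤ d n := by
    simpa [w, Real.sqrt_sq_eq_abs, abs_of_pos (hd0 n)] using
      abs_sqrt_sq_add_sq_sub_le (u x) (d n) (u x) 0
  have hlim (x) : Tendsto (fun n => w n x) atTop (𝓝 |u x|) :=
    tendsto_iff_norm_sub_tendsto_zero.2 <| squeeze_zero (fun _ => norm_nonneg _) (hwu · x)
      tendsto_one_div_add_atTop_nhds_zero_nat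
  have hjump (n p) : |jumpDiff (w n) p| ≤ |jumpDiff u p| := by
    simpa [w, Real.sqrt_sq_eq_abs] using abs_sqrt_sq_add_sq_sub_le (u p.1) (d n) (u p.2) (d n)
  have habs := memLp_jumpDiff_abs hJ (h u hu).1 (h u hu).2
  refine mem_formDomain_of_tendsto hJ (fun n => mem_formDomain_of_mem_core h (hw n))
    (h u hu).1.abs habs ?_ ?_
  · refine tendsto_eLpNorm_of_dominated (by norm_num)
      (fun n => (h _ (hw n)).1.1.sub (h u hu).1.abs.1) (memLp_const 1)
      (fun n => .of_forall fun x => (hwu n x).trans ?_) (.of_forall fun x => ?_)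
    · exact div_le_one_of_le₀ (by linarith [n.cast_nonneg (α := ℝ)]) (by positivity)
    · simpa using (hlim x).sub_const |u x|
  · refine tendsto_eLpNorm_of_dominated (by norm_num) (fun n => (h _ (hw n)).2.1.sub habs.1)
      ((h u hu).2.abs.add (h u hu).2.abs) (fun n => .of_forall fun p => ?_)
      (.of_forall fun p => ?_)
    · exact (norm_sub_le _ _).trans (add_le_add (hjump n p) (abs_jumpDiff_abs_le u p))
    · simpa using ((hlim p.1).sub (hlim p.2)).sub_const (|u p.1| - |u p.2|)

theorem abs_mem_formDomain (hJ : J ≪ Λ.prod Λ) (h : FiniteEnergy Λ J 𝓒) (hC : StableComp 𝓒)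
    {f : E → ℝ} (hf : f ∈ formDomain Λ J 𝓒) : |f| ∈ formDomain Λ J 𝓒 := by
  obtain ⟨u, hu, hval, hgrad, hae⟩ := exists_seq_core_tendsto hJ h hf
  have hf1 := memLp_of_mem_formDomain hf
  have hf2 := memLp_jumpDiff_of_mem_formDomain hJ hf
  refine mem_formDomain_of_tendsto hJ
    (fun n => abs_mem_formDomain_of_mem_core hJ h hC (hu n)) hf1.abs
    (memLp_jumpDiff_abs hJ hf1 hf2) ?_ ?_
  · exact tendsto_of_tendsto_of_tendsto_of_le_of_le tendsto_const_nhds hval (fun _ => zero_le)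
      fun n => eLpNorm_mono fun x => abs_abs_sub_abs_le_abs_sub _ _
  · refine tendsto_eLpNorm_of_norm_le_add (by norm_num) (by norm_num)
      (d := fun n => jumpDiff (u n) - jumpDiff f) (g := fun p => 2 * jumpDiff f p)
      (fun n => (memLp_jumpDiff_abs hJ (h _ (hu n)).1 (h _ (hu n)).2).1.sub
        (memLp_jumpDiff_abs hJ hf1 hf2).1)
      (fun n => (h _ (hu n)).2.1.sub hf2.1) (hf2.const_mul 2) (fun n p => ?_) hgrad ?_
    · calc ‖jumpDiff |u n| p - jumpDiff |f| p‖
          ≤ |jumpDiff (u n) p| + |jumpDiff f p| := (norm_sub_le _ _).trans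
            (add_le_add (abs_jumpDiff_abs_le _ p) (abs_jumpDiff_abs_le _ p))
        _ ≤ |jumpDiff (u n) p - jumpDiff f p| + |jumpDiff f p| + |jumpDiff f p| := by
            gcongr
            simpa using abs_add_le (jumpDiff (u n) p - jumpDiff f p) (jumpDiff f p)
        _ = ‖(jumpDiff (u n) - jumpDiff f) p‖ + ‖2 * jumpDiff f p‖ := by
            rw [norm_mul, Real.norm_two, Pi.sub_apply, Real.norm_eq_abs, Real.norm_eq_abs]
            ring
    · filter_upwards [ae_fst_and_snd hJ hae] with p hp
      simpa using (hp.1.abs.sub hp.2.abs).sub_const (|f p.1| - |f p.2|)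

theorem sup_mem_formDomain (hJ : J ≪ Λ.prod Λ) (h : FiniteEnergy Λ J 𝓒) (hC : StableComp 𝓒)
    {f g : E → ℝ} (hf : f ∈ formDomain Λ J 𝓒) (hg : g ∈ formDomain Λ J 𝓒) :
    f ⊔ g ∈ formDomain Λ J 𝓒 := by
  rw [sup_eq_half_smul_add_add_abs_sub' ℝ]
  exact Submodule.smul_mem _ _ (add_mem (add_mem hf hg)
    (abs_mem_formDomain hJ h hC (sub_mem hg hf)))

theorem inf_mem_formDomain (hJ : J ≪ Λ.prod Λ) (h : FiniteEnergy Λ J 𝓒) (hC : StableComp 𝓒)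
    {f g : E → ℝ} (hf : f ∈ formDomain Λ J 𝓒) (hg : g ∈ formDomain Λ J 𝓒) :
    f ⊓ g ∈ formDomain Λ J 𝓒 := by
  rw [inf_eq_half_smul_add_sub_abs_sub' ℝ]
  exact Submodule.smul_mem _ _ (sub_mem (add_mem hf hg)
    (abs_mem_formDomain hJ h hC (sub_mem hg hf)))

theorem closureForm_markov (hJ : J ≪ Λ.prod Λ) (h : FiniteEnergy Λ J 𝓒) (hC : StableComp 𝓒)
    (u : (closureForm Λ J 𝓒).domain) : ∃ w : (closureForm Λ J 𝓒).domain,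
      ((w : Lp ℝ 2 Λ) : E → ℝ) =ᵐ[Λ] (fun x => min (max ((u : Lp ℝ 2 Λ) x) 0) 1) ∧
      (closureForm Λ J 𝓒).form w w ≤ (closureForm Λ J 𝓒).form u u := by
  have hconst (c : ℝ) : (fun _ => c) ∈ formDomain Λ J 𝓒 :=
    mem_formDomain_of_mem_core h (hC.const_mem c)
  have hclip : (((u : Lp ℝ 2 Λ) : E → ℝ) ⊔ fun _ => 0) ⊓ (fun _ => 1) ∈ formDomain Λ J 𝓒 :=
    inf_mem_formDomain hJ h hC (sup_mem_formDomain hJ h hC ⟨u, .rfl⟩ (hconst 0)) (hconst 1)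
  obtain ⟨w, hw⟩ := hclip
  refine ⟨w, hw, ?_⟩
  rw [closureForm_form, closureForm_form, real_inner_self_eq_norm_sq, real_inner_self_eq_norm_sq]
  refine pow_le_pow_left₀ (norm_nonneg _) (Lp.norm_le_norm_of_ae_le ?_) 2
  filter_upwards [jumpGrad_ae_eq hJ hw, jumpGrad_ae_eq hJ (f := u) .rfl] with p hwp hup
  rw [hwp, hup]
  refine (abs_min_sub_min_le_max _ _ _ _).trans (max_le ?_ (by simp))
  exact (abs_max_sub_max_le_max _ _ _ _).trans (max_le le_rfl (by simp))

end FormDomain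

section BddLip

variable {E : Type*}

/-- The distance truncated at `1`, whose square is integrable under the jump measure. -/
def truncDist [Dist E] (p : E × E) : ℝ := min 1 (dist p.1 p.2)

theorem tendsto_sup'_range_of_approx [PseudoMetricSpace E] {x : ℕ → E} (hx : DenseRange x) {C : ℝ}
    {f : E → ℝ} (hf : Continuous f) {g : ℕ → ℕ → E → ℝ}
    (hg : ∀ k n y z, |g k n y - g k n z| ≤ C * dist y z) (hle : ∀ k n, g k n ≤ f)
    (hlim : ∀ k, Tendsto (fun n => g k n (x k)) atTop (𝓝 (f (x k)))) (y : E) :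
    Tendsto (fun n => (Finset.range (n + 1)).sup' Finset.nonempty_range_add_one (g · n) y)
      atTop (𝓝 (f y)) := by
  refine tendsto_order.2 ⟨fun a ha => ?_, fun a ha => .of_forall fun n =>
    (Finset.sup'_le _ _ (fun k _ => hle k n) y).trans_lt ha⟩
  have hopen : IsOpen {z | a < f z - C * dist y z} := isOpen_lt continuous_const (by fun_prop)
  obtain ⟨k, hk⟩ := hx.exists_mem_open hopen ⟨y, by simpa using ha⟩
  have hk' : a + C * dist y (x k) < f (x k) := lt_sub_iff_add_lt.1 hk
  filter_upwards [(hlim k).eventually_const_lt hk', eventually_ge_atTop k] with n hn hkn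
  calc a < g k n (x k) - C * dist y (x k) := lt_sub_iff_add_lt.2 hn
    _ ≤ g k n y := by linarith [neg_abs_le (g k n y - g k n (x k)), hg k n y (x k)]
    _ ≤ _ := Finset.le_sup' (g · n) (Finset.mem_range_succ_iff.2 hkn) y

variable [MetricSpace E] {C : ℝ} {f g : E → ℝ}

/-- The functions that are bounded by `C` and `C`-Lipschitz for the truncated distance. -/
structure BddLip (C : ℝ) (f : E → ℝ) : Prop where
  abs_le : ∀ x, |f x| ≤ C
  abs_jumpDiff_le : ∀ p, |jumpDiff f p| ≤ C * truncDist p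

namespace BddLip

theorem of_abs_sub_le {A B : ℝ} (hA : ∀ x, |f x| ≤ A)
    (hB : ∀ x y, dist x y ≤ 1 → |f x - f y| ≤ B * dist x y) (hAC : 2 * A ≤ C) (hBC : B ≤ C) :
    BddLip C f where
  abs_le x := by linarith [hA x, (abs_nonneg (f x)).trans (hA x)]
  abs_jumpDiff_le p := by
    rcases le_total 1 (dist p.1 p.2) with h | h
    · rw [truncDist, min_eq_left h, mul_one]
      exact (abs_sub (f p.1) (f p.2)).trans (by linarith [hA p.1, hA p.2])
    · rw [truncDist, min_eq_right h]
      exact (hB _ _ h).trans (mul_le_mul_of_nonneg_right hBC dist_nonneg)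

theorem abs_sub_le (hf : BddLip C f) (x y : E) : |f x - f y| ≤ C * dist x y :=
  (hf.abs_jumpDiff_le (x, y)).trans <|
    mul_le_mul_of_nonneg_left (min_le_right _ _) ((abs_nonneg _).trans (hf.abs_le x))

theorem continuous (hf : BddLip C f) : Continuous f :=
  (LipschitzWith.of_dist_le' hf.abs_sub_le).continuous

theorem sup (hf : BddLip C f) (hg : BddLip C g) : BddLip C (f ⊔ g) where
  abs_le x := abs_max_le_max_abs_abs.trans (max_le (hf.abs_le x) (hg.abs_le x))
  abs_jumpDiff_le p := (abs_max_sub_max_le_max _ _ _ _).trans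
    (max_le (hf.abs_jumpDiff_le p) (hg.abs_jumpDiff_le p))

theorem inf (hf : BddLip C f) (hg : BddLip C g) : BddLip C (f ⊓ g) where
  abs_le x := abs_min_le_max_abs_abs.trans (max_le (hf.abs_le x) (hg.abs_le x))
  abs_jumpDiff_le p := (abs_min_sub_min_le_max _ _ _ _).trans
    (max_le (hf.abs_jumpDiff_le p) (hg.abs_jumpDiff_le p))

theorem of_tendsto {F : ℕ → E → ℝ} (hF : ∀ n, BddLip C (F n))
    (h : ∀ x, Tendsto (fun n => F n x) atTop (𝓝 (f x))) : BddLip C f where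
  abs_le x := le_of_tendsto' (h x).abs fun n => (hF n).abs_le x
  abs_jumpDiff_le p :=
    le_of_tendsto' ((h p.1).sub (h p.2)).abs fun n => (hF n).abs_jumpDiff_le p

end BddLip

theorem abs_arctan_sub_arctan_le (s t : ℝ) : |Real.arctan s - Real.arctan t| ≤ |s - t| := by
  have h : LipschitzWith 1 Real.arctan := by
    refine lipschitzWith_of_nnnorm_deriv_le Real.differentiable_arctan fun x => ?_
    rw [← NNReal.coe_le_coe, coe_nnnorm, Real.deriv_arctan, Real.norm_eq_abs,
      abs_of_nonneg (by positivity)]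
    exact div_le_one_of_le₀ (by nlinarith [sq_nonneg x]) (by positivity)
  simpa [Real.dist_eq] using h.dist_le_mul s t

theorem abs_arctan_le_two (s : ℝ) : |Real.arctan s| ≤ 2 :=
  abs_le.2 ⟨by linarith [Real.neg_pi_div_two_lt_arctan s, Real.pi_lt_four],
    by linarith [Real.arctan_lt_pi_div_two s, Real.pi_lt_four]⟩

/-- The bounded distance `arctan (dist x ν)` to the point `ν`. -/
def arctanDist (ν x : E) : ℝ := Real.arctan (dist x ν)

theorem arctanDist_nonneg (ν x : E) : 0 ≤ arctanDist ν x := Real.arctan_nonneg.2 dist_nonneg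

theorem arctanDist_comm (ν x : E) : arctanDist ν x = arctanDist x ν := by
  rw [arctanDist, arctanDist, dist_comm]

theorem arctanDist_self (ν : E) : arctanDist ν ν = 0 := by simp [arctanDist]

theorem bddLip_arctanDist (ν : E) : BddLip 4 (arctanDist ν) := by
  refine .of_abs_sub_le (A := 2) (B := 1) (fun _ => abs_arctan_le_two _) (fun x y _ => ?_)
    (by norm_num) (by norm_num)
  calc |arctanDist ν x - arctanDist ν y| ≤ |dist x ν - dist y ν| := abs_arctan_sub_arctan_le _ _
    _ ≤ dist x y := abs_dist_sub_le x y ν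
    _ = 1 * dist x y := (one_mul _).symm

/-- A space of bounded Lipschitz functions, stable under composition with functions of class `C¹`,
from which the distance to every point can be recovered. -/
structure LipschitzCore (𝓒 : Submodule ℝ (E → ℝ)) : Prop where
  bddLip : ∀ u ∈ 𝓒, ∃ C, BddLip C u
  stableComp : StableComp 𝓒
  approx_arctanDist : ∀ ν μ : E, ∀ ε > 0,
    ∃ g ∈ 𝓒, BddLip 4 g ∧ g ≤ arctanDist ν ∧ arctanDist ν μ - ε < g μ

end BddLip

section L2Density

theorem ae_eq_zero_of_forall_integral_mul_eq_zero {E : Type*} [TopologicalSpace E] [PolishSpace E]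
    [MeasurableSpace E] [BorelSpace E] {Λ : Measure E} {g : E → ℝ} (hg : Integrable g Λ)
    {A : StarSubalgebra ℝ (BoundedContinuousFunction E ℝ)}
    (hA : (A.map (BoundedContinuousFunction.toContinuousMapStarₐ ℝ)).SeparatesPoints)
    (h : ∀ u ∈ A, ∫ x, g x * u x ∂Λ = 0) : g =ᵐ[Λ] 0 := by
  let pos (x : E) : ℝ≥0∞ := ENNReal.ofReal (g x)
  let neg (x : E) : ℝ≥0∞ := ENNReal.ofReal (-g x)
  have hpos : AEMeasurable pos Λ := hg.1.aemeasurable.ennreal_ofReal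
  have hneg : AEMeasurable neg Λ := hg.1.aemeasurable.neg.ennreal_ofReal
  have hpos_fin : ∫⁻ x, pos x ∂Λ ≠ ∞ := hg.lintegral_lt_top.ne
  have hneg_fin : ∫⁻ x, neg x ∂Λ ≠ ∞ := hg.neg.lintegral_lt_top.ne
  have := isFiniteMeasure_withDensity hpos_fin
  have := isFiniteMeasure_withDensity hneg_fin
  have hint {k : E → ℝ≥0∞} (hk : AEMeasurable k Λ) (hk' : ∫⁻ x, k x ∂Λ ≠ ∞)
      (u : BoundedContinuousFunction E ℝ) : Integrable (fun x => (k x).toReal • u x) Λ :=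
    (integrable_toReal_of_lintegral_ne_top hk hk').mul_bdd (c := ‖u‖)
      u.continuous.aestronglyMeasurable (.of_forall u.norm_coe_le_norm)
  have hparts (x) : (pos x).toReal - (neg x).toReal = g x := by
    simp only [pos, neg, ENNReal.toReal_ofReal', max_zero_sub_max_neg_zero_eq_self]
  have heq : Λ.withDensity pos = Λ.withDensity neg := by
    refine ext_of_forall_mem_subalgebra_integral_eq_of_polish hA fun u hu => ?_
    rw [integral_withDensity_eq_integral_toReal_smul₀ hpos (by simp [pos]),
      integral_withDensity_eq_integral_toReal_smul₀ hneg (by simp [neg]), ← sub_eq_zero,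
      ← integral_sub (hint hpos hpos_fin u) (hint hneg hneg_fin u), ← h u hu]
    simp only [smul_eq_mul, ← sub_mul, hparts]
  filter_upwards [(withDensity_eq_iff hpos hneg hpos_fin).1 heq] with x hx
  rw [← hparts x, hx, sub_self, Pi.zero_apply]

variable {E : Type*} [MetricSpace E] {𝓒 : Submodule ℝ (E → ℝ)}

/-- The bounded continuous functions that belong to the core. -/
def LipschitzCore.starSubalgebra (hC : LipschitzCore 𝓒) :
    StarSubalgebra ℝ (BoundedContinuousFunction E ℝ) where
  carrier := {u | (u : E → ℝ) ∈ 𝓒}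
  mul_mem' hu hv := hC.stableComp.mul_mem hu hv
  add_mem' hu hv := 𝓒.add_mem hu hv
  algebraMap_mem' c := hC.stableComp.const_mem c
  star_mem' hu := by simpa using hu

theorem LipschitzCore.separatesPoints (hC : LipschitzCore 𝓒) :
    (hC.starSubalgebra.map
      (BoundedContinuousFunction.toContinuousMapStarₐ ℝ)).SeparatesPoints := by
  intro x y hxy
  have hpos : 0 < arctanDist y x := Real.arctan_pos.2 (dist_pos.2 hxy)
  obtain ⟨g, hg, hgL, hg_le, hgt⟩ := hC.approx_arctanDist y x _ hpos
  refine ⟨g, ⟨_, ⟨.ofNormedAddCommGroup g hgL.continuous 4 hgL.abs_le, hg, rfl⟩, rfl⟩,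
    fun hgxy => ?_⟩
  rw [sub_self, hgxy] at hgt
  exact hgt.not_ge ((hg_le y).trans_eq (arctanDist_self y))

end L2Density

section Metric

variable {E : Type*} [MetricSpace E] [MeasurableSpace E] [BorelSpace E]
  {Λ : Measure E} {J : Measure (E × E)} {𝓒 : Submodule ℝ (E → ℝ)} {C : ℝ} {f : E → ℝ}

theorem BddLip.memLp [IsFiniteMeasure Λ] (hf : BddLip C f) : MemLp f 2 Λ :=
  .of_bound hf.continuous.aestronglyMeasurable C (.of_forall hf.abs_le)

variable [SecondCountableTopology E]

theorem memLp_truncDist (hJ1 : ∫⁻ p, ENNReal.ofReal (min 1 (dist p.1 p.2 ^ 2)) ∂J < ∞) :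
    MemLp truncDist 2 J := by
  have hcont : Continuous (truncDist (E := E)) := by unfold truncDist; fun_prop
  rw [memLp_two_iff_integrable_sq hcont.aestronglyMeasurable]
  refine ⟨(hcont.pow 2).aestronglyMeasurable, ?_⟩
  rw [hasFiniteIntegral_iff_ofReal (.of_forall fun p => sq_nonneg _)]
  have hsq (p : E × E) : truncDist p ^ 2 = min 1 (dist p.1 p.2 ^ 2) := by
    simpa only [truncDist, one_pow] using
      (pow_left_monotoneOn (n := 2)).map_min (mem_Ici.2 zero_le_one)
      (mem_Ici.2 (dist_nonneg (x := p.1) (y := p.2)))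
  simpa only [hsq] using hJ1

theorem BddLip.memLp_jumpDiff (hJ1 : MemLp truncDist 2 J) (hf : BddLip C f) :
    MemLp (jumpDiff f) 2 J := by
  have hcont : Continuous (jumpDiff f) :=
    (hf.continuous.comp continuous_fst).sub (hf.continuous.comp continuous_snd)
  exact (hJ1.const_mul C).mono hcont.aestronglyMeasurable
    (.of_forall fun p => (hf.abs_jumpDiff_le p).trans (le_abs_self _))

theorem BddLip.tendsto_eLpNorm [IsFiniteMeasure Λ] (hJ1 : MemLp truncDist 2 J) {F : ℕ → E → ℝ}
    (hF : ∀ n, BddLip C (F n)) (h : ∀ x, Tendsto (fun n => F n x) atTop (𝓝 (f x))) :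
    Tendsto (fun n => eLpNorm (F n - f) 2 Λ) atTop (𝓝 0) ∧
      Tendsto (fun n => eLpNorm (jumpDiff (F n) - jumpDiff f) 2 J) atTop (𝓝 0) := by
  have hf := BddLip.of_tendsto hF h
  constructor
  · refine tendsto_eLpNorm_of_dominated (by norm_num) (fun n => (hF n).memLp.1.sub hf.memLp.1)
      (memLp_const (C + C)) (fun n => .of_forall fun x => ?_) (.of_forall fun x => ?_)
    · exact (norm_sub_le _ _).trans (add_le_add ((hF n).abs_le x) (hf.abs_le x))
    · simpa using (h x).sub_const (f x)
  · refine tendsto_eLpNorm_of_dominated (by norm_num)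
      (fun n => ((hF n).memLp_jumpDiff hJ1).1.sub (hf.memLp_jumpDiff hJ1).1)
      ((hJ1.const_mul C).add (hJ1.const_mul C)) (fun n => .of_forall fun p => ?_)
      (.of_forall fun p => ?_)
    · exact (norm_sub_le _ _).trans
        (add_le_add ((hF n).abs_jumpDiff_le p) (hf.abs_jumpDiff_le p))
    · simpa using ((h p.1).sub (h p.2)).sub_const (f p.1 - f p.2)

namespace LipschitzCore

variable [IsFiniteMeasure Λ]

theorem finiteEnergy (hC : LipschitzCore 𝓒) (hJ1 : MemLp truncDist 2 J) :
    FiniteEnergy Λ J 𝓒 := by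
  intro u hu
  obtain ⟨C, huC⟩ := hC.bddLip u hu
  exact ⟨huC.memLp, huC.memLp_jumpDiff hJ1⟩

theorem arctanDist_mem_formDomain (hC : LipschitzCore 𝓒) (hJ : J ≪ Λ.prod Λ)
    (hJ1 : MemLp truncDist 2 J) (ν : E) : arctanDist ν ∈ formDomain Λ J 𝓒 := by
  have : Nonempty E := ⟨ν⟩
  have hE : FiniteEnergy Λ J 𝓒 := hC.finiteEnergy hJ1
  let x := TopologicalSpace.denseSeq E
  choose g hg hgL hg_le hg_lt using
    fun k n : ℕ => hC.approx_arctanDist ν (x k) (1 / (n + 1)) Nat.one_div_pos_of_nat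
  have hlim (k : ℕ) : Tendsto (fun n => g k n (x k)) atTop (𝓝 (arctanDist ν (x k))) :=
    tendsto_of_tendsto_of_tendsto_of_le_of_le
      (by simpa using tendsto_one_div_add_atTop_nhds_zero_nat.const_sub (arctanDist ν (x k)))
      tendsto_const_nhds (fun n => (hg_lt k n).le) fun n => hg_le k n (x k)
  let G (n : ℕ) : E → ℝ := (Finset.range (n + 1)).sup' Finset.nonempty_range_add_one (g · n)
  have hG_mem (n) : G n ∈ formDomain Λ J 𝓒 :=
    Finset.sup'_induction _ _ (fun _ h₁ _ h₂ => sup_mem_formDomain hJ hE hC.stableComp h₁ h₂)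
      fun k _ => mem_formDomain_of_mem_core hE (hg k n)
  have hG (n) : BddLip 4 (G n) :=
    Finset.sup'_induction _ _ (fun _ h₁ _ h₂ => h₁.sup h₂) fun k _ => hgL k n
  have hGlim := tendsto_sup'_range_of_approx (TopologicalSpace.denseRange_denseSeq E)
    (bddLip_arctanDist ν).continuous (fun k n => (hgL k n).abs_sub_le) hg_le hlim
  obtain ⟨hval, hgrad⟩ := BddLip.tendsto_eLpNorm (Λ := Λ) hJ1 hG hGlim
  exact mem_formDomain_of_tendsto hJ hG_mem (bddLip_arctanDist ν).memLp
    ((bddLip_arctanDist ν).memLp_jumpDiff hJ1) hval hgrad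

theorem dense_domain [CompleteSpace E] (hC : LipschitzCore 𝓒) (hJ1 : MemLp truncDist 2 J) :
    Dense ((closureForm Λ J 𝓒).domain : Set (Lp ℝ 2 Λ)) := by
  have hE : FiniteEnergy Λ J 𝓒 := hC.finiteEnergy hJ1
  rw [Submodule.dense_iff_topologicalClosure_eq_top, Submodule.topologicalClosure_eq_top_iff,
    Submodule.eq_bot_iff]
  intro g hg
  refine Lp.ext (.trans ?_ (Lp.coeFn_zero _ _ _).symm)
  refine ae_eq_zero_of_forall_integral_mul_eq_zero ((Lp.memLp g).integrable (by norm_num))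
    hC.separatesPoints fun u hu => ?_
  have horth := hg _ (mem_closureForm_domain.2 ⟨_, graphPoint_mem hu (hE u hu)⟩)
  rw [L2.inner_def] at horth
  rw [← horth]
  refine integral_congr_ae ?_
  filter_upwards [(hE u hu).1.coeFn_toLp] with x hx
  simp [hx]

theorem isDirichlet [CompleteSpace E] {Λ : Measure E} [IsProbabilityMeasure Λ]
    (hC : LipschitzCore 𝓒) (hJ : J ≪ Λ.prod Λ) (hJ1 : MemLp truncDist 2 J) :
    (closureForm Λ J 𝓒).IsDirichlet where
  dense_domain := hC.dense_domain hJ1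
  symm u v := by rw [closureForm_form, closureForm_form, real_inner_comm]
  nonneg u := by
    rw [closureForm_form]
    exact real_inner_self_nonneg
  coercive := ⟨1, one_pos, fun u v => by simpa using abs_closureForm_form1_le u v⟩
  complete := closureForm_complete hJ
  markov := closureForm_markov hJ (hC.finiteEnergy hJ1) hC.stableComp
  one_mem := mem_closureForm_domain.2 ⟨_, graphPoint_mem (hC.stableComp.const_mem 1)
    (hC.finiteEnergy hJ1 _ (hC.stableComp.const_mem 1))⟩

end LipschitzCore

end Metric

section Tsum

variable {E : Type*} [MeasurableSpace E] {Λ : Measure E} {J : Measure (E × E)}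

theorem ae_le_tsum_fst {p : ℕ → Lp ℝ 2 Λ × Lp ℝ 2 J} (hp : Summable p) {v : ℕ → E → ℝ}
    (hv : ∀ k, (p k).1 =ᵐ[Λ] v k) (hv0 : ∀ k, 0 ≤ v k) :
    ∀ᵐ x ∂Λ, ∀ k, v k x ≤ (∑' k, p k).1 x := by
  refine ae_all_iff.2 fun k => ?_
  have hsum : HasSum (fun k => (p k).1) (∑' k, p k).1 :=
    hp.hasSum.map (AddMonoidHom.fst _ _) continuous_fst
  have hle : (p k).1 ≤ (∑' k, p k).1 := le_hasSum hsum k fun j _ => by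
    rw [← Lp.coeFn_nonneg]
    filter_upwards [hv j] with x hx
    exact (hv0 j x).trans_eq hx.symm
  filter_upwards [(Lp.coeFn_le _ _).2 hle, hv k] with x hx hvx
  rwa [hvx] at hx

end Tsum

section Capacity

variable {E : Type*} [TopologicalSpace E] [MeasurableSpace E] {Λ : Measure E}

theorem L2Form.cap_le (𝓔 : L2Form Λ) {O : Set E} (hO : IsOpen O) (u : 𝓔.domain)
    (hu : ∀ᵐ x ∂Λ, x ∈ O → 1 ≤ (u : Lp ℝ 2 Λ) x) : 𝓔.cap O ≤ ENNReal.ofReal (𝓔.form1 u u) :=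
  (iInf_le_of_le O (iInf₂_le hO subset_rfl)).trans (iInf₂_le u hu)

theorem L2Form.cap_empty (𝓔 : L2Form Λ) : 𝓔.cap ∅ = 0 := by
  refine le_antisymm ((𝓔.cap_le isOpen_empty 0 (by simp)).trans_eq ?_) zero_le
  rw [L2Form.form1, map_zero, zero_add, ENNReal.ofReal_eq_zero]
  refine (integral_eq_zero_of_ae ?_).le
  filter_upwards [Lp.coeFn_zero ℝ 2 Λ] with x hx
  exact mul_eq_zero_of_left hx _

theorem L2Form.quasiContinuous_of_continuous [OpensMeasurableSpace E] (𝓔 : L2Form Λ) {f : E → ℝ}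
    (hf : Continuous f) : 𝓔.QuasiContinuous f :=
  ⟨hf.measurable, fun _ => univ, ⟨fun _ => isClosed_univ, by simp [𝓔.cap_empty]⟩,
    fun _ => hf.continuousOn⟩

variable {J : Measure (E × E)} {𝓒 : Submodule ℝ (E → ℝ)}

theorem cap_closureForm_le [SFinite Λ] (hJ : J ≪ Λ.prod Λ) {q : Lp ℝ 2 Λ × Lp ℝ 2 J}
    (hq : q ∈ closedGraph Λ J 𝓒) {O : Set E} (hO : IsOpen O) (h : ∀ᵐ x ∂Λ, x ∈ O → 1 ≤ q.1 x) :
    (closureForm Λ J 𝓒).cap O ≤ ENNReal.ofReal (‖q.2‖ ^ 2 + ‖q.1‖ ^ 2) := by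
  let w : (closureForm Λ J 𝓒).domain := ⟨q.1, mem_closureForm_domain.2 ⟨q.2, hq⟩⟩
  refine (L2Form.cap_le _ hO w h).trans_eq ?_
  rw [closureForm_form1_self, jumpGrad_eq hJ w hq]

theorem isNest_of_summable [SFinite Λ] (hJ : J ≪ Λ.prod Λ) {v : ℕ → E → ℝ}
    (hcont : ∀ k, Continuous (v k)) (hv0 : ∀ k, 0 ≤ v k) {p : ℕ → Lp ℝ 2 Λ × Lp ℝ 2 J}
    (hp : ∀ k, p k ∈ closedGraph Λ J 𝓒) (hpv : ∀ k, (p k).1 =ᵐ[Λ] v k) (hsum : Summable p) :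
    (closureForm Λ J 𝓒).IsNest fun m => {x | ∀ k, v (k + m) x ≤ 1} := by
  have hclosed (m : ℕ) : IsClosed {x | ∀ k, v (k + m) x ≤ 1} := by
    rw [ofPred_forall]
    exact isClosed_iInter fun k => isClosed_le (hcont _) continuous_const
  let tail (m : ℕ) : Lp ℝ 2 Λ × Lp ℝ 2 J := ∑' k, p (k + m)
  have hsum' (m : ℕ) : Summable fun k => p (k + m) := (summable_nat_add_iff m).2 hsum
  have htail_mem (m : ℕ) : tail m ∈ closedGraph Λ J 𝓒 :=
    isClosed_closedGraph.mem_of_tendsto (hsum' m).hasSum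
      (.of_forall fun s => Submodule.sum_mem _ fun k _ => hp _)
  have hcap (m : ℕ) : (closureForm Λ J 𝓒).cap {x | ∀ k, v (k + m) x ≤ 1}ᶜ ≤
      ENNReal.ofReal (‖(tail m).2‖ ^ 2 + ‖(tail m).1‖ ^ 2) := by
    refine cap_closureForm_le hJ (htail_mem m) (hclosed m).isOpen_compl ?_
    filter_upwards [ae_le_tsum_fst (hsum' m) (fun k => hpv (k + m)) fun k => hv0 (k + m)]
      with x hx hxm
    obtain ⟨k, hk⟩ := not_forall.1 hxm
    exact (not_le.1 hk).le.trans (hx k)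
  have htail : Tendsto tail atTop (𝓝 0) := tendsto_sum_nat_add p
  have hlim : Tendsto (fun m => ENNReal.ofReal (‖(tail m).2‖ ^ 2 + ‖(tail m).1‖ ^ 2))
      atTop (𝓝 0) := by
    simpa using ENNReal.tendsto_ofReal
      ((htail.snd_nhds.norm.pow 2).add (htail.fst_nhds.norm.pow 2))
  exact ⟨hclosed, tendsto_of_tendsto_of_tendsto_of_le_of_le tendsto_const_nhds hlim
    (fun _ => zero_le) hcap⟩

theorem exists_isNest_subseq [SFinite Λ] (hJ : J ≪ Λ.prod Λ) {u : ℕ → E → ℝ}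
    (hu : ∀ n, u n ∈ formDomain Λ J 𝓒) (hcont : ∀ n, Continuous (u n)) (hu0 : ∀ n, 0 ≤ u n)
    (hval : Tendsto (fun n => eLpNorm (u n) 2 Λ) atTop (𝓝 0))
    (hgrad : Tendsto (fun n => eLpNorm (jumpDiff (u n)) 2 J) atTop (𝓝 0)) :
    ∃ ns : ℕ → ℕ, (closureForm Λ J 𝓒).IsNest
      fun m => {x | ∀ k, ((k + m : ℕ) + 1) * u (ns (k + m)) x ≤ 1} := by
  choose w hw using hu
  let q (n : ℕ) : Lp ℝ 2 Λ × Lp ℝ 2 J := (w n, jumpGrad Λ J 𝓒 (w n))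
  have hw0 : Tendsto (fun n => (w n : Lp ℝ 2 Λ)) atTop (𝓝 0) := by
    simpa only [MemLp.toLp_zero] using
      tendsto_toLp_of_eLpNorm (g := 0) (q := fun n => (w n : Lp ℝ 2 Λ)) .zero hw
        (by simpa only [sub_zero] using hval)
  have hg0 : Tendsto (fun n => jumpGrad Λ J 𝓒 (w n)) atTop (𝓝 0) := by
    simpa only [MemLp.toLp_zero] using
      tendsto_toLp_of_eLpNorm (g := 0) (q := fun n => jumpGrad Λ J 𝓒 (w n)) .zero
      (fun n => jumpGrad_ae_eq hJ (hw n)) (by simpa only [sub_zero] using hgrad)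
  have hq : Tendsto q atTop (𝓝 0) := hw0.prodMk_nhds hg0
  have hsmall (k : ℕ) : ∃ n, ‖((k : ℝ) + 1) • q n‖ < (1 / 2 : ℝ) ^ k := by
    have hk := (hq.const_smul ((k : ℝ) + 1)).norm
    rw [smul_zero, norm_zero] at hk
    exact (hk.eventually_lt_const (by positivity)).exists
  choose ns hns using hsmall
  let p (k : ℕ) : Lp ℝ 2 Λ × Lp ℝ 2 J := ((k : ℝ) + 1) • q (ns k)
  have hp (k) : p k ∈ closedGraph Λ J 𝓒 := Submodule.smul_mem _ _ (jumpGrad_mem hJ _)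
  have hpu (k) : (p k).1 =ᵐ[Λ] fun x => ((k : ℝ) + 1) * u (ns k) x :=
    (Lp.coeFn_smul _ _).trans ((hw (ns k)).const_smul ((k : ℝ) + 1))
  have hsum : Summable p := .of_norm_bounded summable_geometric_two fun k => (hns k).le
  exact ⟨ns, isNest_of_summable hJ (fun k => (hcont _).const_mul _)
    (fun k x => mul_nonneg (by positivity) (hu0 _ x)) hp hpu hsum⟩

end Capacity

section CoreClasses

variable {E : Type*} [MeasurableSpace E] {Λ : Measure E} {J : Measure (E × E)}
  {𝓒 : Submodule ℝ (E → ℝ)}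

variable (Λ J 𝓒) in
/-- The classes in `L²(Λ)` of the functions of the core. -/
def coreClasses : Submodule ℝ (closureForm Λ J 𝓒).domain :=
  ((coreGraph Λ J 𝓒).map (LinearMap.fst ℝ _ _)).comap (closureForm Λ J 𝓒).domain.subtype

theorem exists_mem_coreClasses_form1_lt [SFinite Λ] (hJ : J ≪ Λ.prod Λ)
    (w : (closureForm Λ J 𝓒).domain) {ε : ℝ} (hε : 0 < ε) :
    ∃ v ∈ coreClasses Λ J 𝓒, (closureForm Λ J 𝓒).form1 (w - v) (w - v) < ε := by
  have hopen : IsOpen {q : Lp ℝ 2 Λ × Lp ℝ 2 J |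
      ‖jumpGrad Λ J 𝓒 w - q.2‖ ^ 2 + ‖(w : Lp ℝ 2 Λ) - q.1‖ ^ 2 < ε} :=
    isOpen_lt (by fun_prop) continuous_const
  obtain ⟨q, hqε, hq⟩ := mem_closure_iff.1 (jumpGrad_mem hJ w) _ hopen (by simpa using hε)
  have hq' : q ∈ closedGraph Λ J 𝓒 := subset_closure hq
  let v : (closureForm Λ J 𝓒).domain := ⟨q.1, mem_closureForm_domain.2 ⟨q.2, hq'⟩⟩
  refine ⟨v, ⟨q, hq, rfl⟩, ?_⟩
  rwa [closureForm_form1_self, map_sub, jumpGrad_eq hJ v hq', Submodule.coe_sub]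

end CoreClasses

section Nets

variable {E : Type*} [MetricSpace E] {a : ℕ → E}

/-- The bounded distance to the set `{a 0, …, a n}`. -/
def arctanDistNet (a : ℕ → E) (n : ℕ) : E → ℝ :=
  (Finset.range (n + 1)).inf' Finset.nonempty_range_add_one fun k => arctanDist (a k)

theorem arctanDistNet_nonneg (a : ℕ → E) (n : ℕ) : 0 ≤ arctanDistNet a n :=
  Finset.le_inf' _ _ fun k _ => arctanDist_nonneg (a k)

theorem bddLip_arctanDistNet (a : ℕ → E) (n : ℕ) : BddLip 4 (arctanDistNet a n) :=
  Finset.inf'_induction _ _ (fun _ h₁ _ h₂ => h₁.inf h₂) fun k _ => bddLip_arctanDist (a k)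

theorem tendsto_arctanDistNet (ha : DenseRange a) (x : E) :
    Tendsto (fun n => arctanDistNet a n x) atTop (𝓝 0) := by
  refine tendsto_order.2 ⟨fun b hb => .of_forall fun n =>
    hb.trans_le (arctanDistNet_nonneg a n x), fun b hb => ?_⟩
  obtain ⟨k, hk⟩ := ha.exists_mem_open
    (isOpen_lt (bddLip_arctanDist x).continuous continuous_const)
    ⟨x, by simpa [arctanDist_self] using hb⟩
  filter_upwards [eventually_ge_atTop k] with n hn
  calc arctanDistNet a n x ≤ arctanDist (a k) x :=
        Finset.inf'_le (fun k => arctanDist (a k)) (Finset.mem_range_succ_iff.2 hn) x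
    _ < b := (arctanDist_comm _ _).trans_lt hk

theorem exists_dist_lt_of_arctanDistNet_lt {n : ℕ} {x : E} {s : ℝ}
    (h : arctanDistNet a n x < Real.arctan s) : ∃ k ≤ n, dist x (a k) < s := by
  rw [arctanDistNet, Finset.inf'_apply, Finset.inf'_lt_iff] at h
  obtain ⟨k, hk, hks⟩ := h
  exact ⟨k, Finset.mem_range_succ_iff.1 hk, Real.arctan_lt_arctan_iff.1 hks⟩

theorem totallyBounded_of_arctanDistNet {K : Set E}
    (h : ∀ ε > 0, ∃ n, ∀ x ∈ K, arctanDistNet a n x < Real.arctan ε) : TotallyBounded K := by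
  refine Metric.totallyBounded_iff.2 fun ε hε => ?_
  obtain ⟨n, hn⟩ := h ε hε
  refine ⟨a '' Iic n, (finite_Iic n).image a, fun x hx => ?_⟩
  obtain ⟨k, hk, hkε⟩ := exists_dist_lt_of_arctanDistNet_lt (hn x hx)
  exact mem_biUnion (mem_image_of_mem a hk) hkε

theorem exists_arctanDist_ne (ha : DenseRange a) {x y : E} (hxy : x ≠ y) :
    ∃ k, arctanDist (a k) x ≠ arctanDist (a k) y := by
  by_contra! hall
  have heq : (arctanDist x : E → ℝ) = arctanDist y :=
    ha.equalizer (bddLip_arctanDist x).continuous (bddLip_arctanDist y).continuous <|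
      funext fun k => by simpa [arctanDist_comm] using hall k
  have h0 : Real.arctan (dist x y) = 0 := (congrFun heq x).symm.trans (arctanDist_self x)
  exact hxy (dist_eq_zero.1 (Real.arctan_eq_zero_iff.1 h0))

end Nets

section QuasiRegular

variable {E : Type*} [MetricSpace E] [MeasurableSpace E] [BorelSpace E]
  [SecondCountableTopology E] [CompleteSpace E] {Λ : Measure E} {J : Measure (E × E)}
  {𝓒 : Submodule ℝ (E → ℝ)}

namespace LipschitzCore

theorem exists_compact_nest [IsFiniteMeasure Λ] [Nonempty E] (hC : LipschitzCore 𝓒)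
    (hJ : J ≪ Λ.prod Λ) (hJ1 : MemLp truncDist 2 J) :
    ∃ K : ℕ → Set E, (closureForm Λ J 𝓒).IsNest K ∧ ∀ n, IsCompact (K n) := by
  have hE : FiniteEnergy Λ J 𝓒 := hC.finiteEnergy hJ1
  let u := arctanDistNet (TopologicalSpace.denseSeq E)
  have hu (n) : u n ∈ formDomain Λ J 𝓒 :=
    Finset.inf'_induction _ _ (fun _ h₁ _ h₂ => inf_mem_formDomain hJ hE hC.stableComp h₁ h₂)
      fun k _ => hC.arctanDist_mem_formDomain hJ hJ1 _
  have huL (n) : BddLip 4 (u n) := bddLip_arctanDistNet _ n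
  obtain ⟨hval, hgrad⟩ := BddLip.tendsto_eLpNorm (Λ := Λ) (f := 0) hJ1 huL
    (tendsto_arctanDistNet (TopologicalSpace.denseRange_denseSeq E))
  simp only [map_zero, sub_zero] at hval hgrad
  obtain ⟨ns, hns⟩ := exists_isNest_subseq hJ hu (fun n => (huL n).continuous)
    (arctanDistNet_nonneg _) hval hgrad
  refine ⟨_, hns, fun m => isCompact_iff_totallyBounded_isComplete.2
    ⟨totallyBounded_of_arctanDistNet (a := TopologicalSpace.denseSeq E) fun ε hε => ?_,
      (hns.1 m).isComplete⟩⟩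
  obtain ⟨k, hk⟩ := exists_nat_one_div_lt (Real.arctan_pos.2 hε)
  refine ⟨ns (k + m), fun x hx => ?_⟩
  calc u (ns (k + m)) x ≤ 1 / ((k + m : ℕ) + 1) :=
        (le_div_iff₀' (by positivity)).2 (hx k)
    _ ≤ 1 / (k + 1) := Nat.one_div_le_one_div (Nat.le_add_right k m)
    _ < Real.arctan ε := hk

theorem isQuasiRegular [IsProbabilityMeasure Λ] (hC : LipschitzCore 𝓒) (hJ : J ≪ Λ.prod Λ)
    (hJ1 : MemLp truncDist 2 J) : (closureForm Λ J 𝓒).IsQuasiRegular := by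
  have : Nonempty E := nonempty_of_isProbabilityMeasure Λ
  refine ⟨hC.exists_compact_nest hJ hJ1, ⟨coreClasses Λ J 𝓒, ?_, fun w ε hε =>
    exists_mem_coreClasses_form1_lt hJ w hε⟩, ∅, L2Form.cap_empty _,
    fun n => arctanDist (TopologicalSpace.denseSeq E n), fun n => ⟨?_, ?_⟩, fun x _ y _ =>
    exists_arctanDist_ne (TopologicalSpace.denseRange_denseSeq E)⟩
  · rintro v ⟨q, ⟨f, hf, hqf, -⟩, hqv⟩
    obtain ⟨C, hfC⟩ := hC.bddLip f hf
    refine ⟨f, L2Form.quasiContinuous_of_continuous _ hfC.continuous, ?_⟩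
    have hv : q.1 = (v : Lp ℝ 2 Λ) := hqv
    rw [← hv]
    exact hqf.symm
  · exact L2Form.quasiContinuous_of_continuous _ (bddLip_arctanDist _).continuous
  · obtain ⟨w, hw⟩ := hC.arctanDist_mem_formDomain hJ hJ1 (TopologicalSpace.denseSeq E n)
    exact ⟨w, hw.symm⟩

theorem jumpForm_closure [IsProbabilityMeasure Λ] (hC : LipschitzCore 𝓒)
    (hJ1 : ∫⁻ p, ENNReal.ofReal (min 1 (dist p.1 p.2 ^ 2)) ∂J < ∞) (hJ : J ≪ Λ.prod Λ) :
    (∀ u ∈ 𝓒, MemLp u 2 Λ) ∧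
      (∀ u ∈ 𝓒, ∀ v ∈ 𝓒, Integrable (fun p => (u p.1 - u p.2) * (v p.1 - v p.2)) J) ∧
      IsClosable Λ 𝓒 (jumpForm J) ∧
      ∃ 𝓔 : L2Form Λ, IsClosure Λ 𝓒 (jumpForm J) 𝓔 ∧ 𝓔.IsDirichlet ∧ 𝓔.IsQuasiRegular :=
  have hJ2 := memLp_truncDist hJ1
  have hE : FiniteEnergy Λ J 𝓒 := hC.finiteEnergy hJ2
  ⟨fun u hu => (hE u hu).1, fun u hu v hv => (hE u hu).2.integrable_mul (hE v hv).2,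
    isClosable_jumpForm hJ hE, closureForm Λ J 𝓒, isClosure_closureForm hJ hE,
    hC.isDirichlet hJ hJ2, hC.isQuasiRegular hJ hJ2⟩

end LipschitzCore

end QuasiRegular

section DiracMass

variable {M : Type*} [MeasurableSpace M]

theorem mass_add (μ ν : FiniteMeasure M) : (μ + ν).mass = μ.mass + ν.mass := by
  simp only [FiniteMeasure.mass, FiniteMeasure.coeFn_add, Pi.add_apply]

theorem mass_pos {κ : FiniteMeasure M} (hκ : κ ≠ 0) : 0 < κ.mass :=
  pos_iff_ne_zero.2 (κ.mass_nonzero_iff.2 hκ)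

theorem add_ne_zero_left {κ : FiniteMeasure M} (hκ : κ ≠ 0) (ν : FiniteMeasure M) :
    κ + ν ≠ 0 := by
  rw [← FiniteMeasure.mass_nonzero_iff, mass_add]
  exact (add_pos_of_pos_of_nonneg (mass_pos hκ) zero_le).ne'

/-- The Dirac measure, as a finite measure. -/
abbrev diracFin (x : M) : FiniteMeasure M := (diracProba x).toFiniteMeasure

theorem toMeasure_diracFin (x : M) : (diracFin x : Measure M) = Measure.dirac x := rfl

theorem mass_smul_dirac (c : ℝ≥0) (x : M) : (c • diracFin x).mass = c := by
  simp [FiniteMeasure.mass]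

theorem normalize_add_smul_dirac [Nonempty M] {κ : FiniteMeasure M} (hκ : κ ≠ 0) (ε : ℝ≥0)
    (x : M) {t : unitInterval} (ht : (t : ℝ) = ε / (κ.mass + ε)) :
    (κ + ε • diracFin x).normalize = mixDirac t κ.normalize x := by
  have hm₀ : κ.mass ≠ 0 := (mass_pos hκ).ne'
  have ht₀ : ENNReal.ofReal t = (ε / (κ.mass + ε) : ℝ≥0) := by
    rw [ht, ← ENNReal.ofReal_coe_nnreal]
    simp
  have ht₁ : ENNReal.ofReal (1 - t) = (κ.mass / (κ.mass + ε) : ℝ≥0) := by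
    rw [ht, ← ENNReal.ofReal_coe_nnreal]
    congr 1
    have : (0 : ℝ) < κ.mass := mass_pos hκ
    push_cast
    field_simp
    ring
  apply ProbabilityMeasure.toMeasure_injective
  change _ = ENNReal.ofReal (1 - t) • (κ.normalize : Measure M) +
    ENNReal.ofReal t • Measure.dirac x
  rw [FiniteMeasure.toMeasure_normalize_eq_of_nonzero _ (add_ne_zero_left hκ _),
    FiniteMeasure.toMeasure_normalize_eq_of_nonzero _ hκ, mass_add, mass_smul_dirac,
    FiniteMeasure.toMeasure_add, FiniteMeasure.toMeasure_smul, toMeasure_diracFin, ht₀, ht₁,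
    Measure.coe_nnreal_smul, Measure.coe_nnreal_smul, smul_add, smul_smul, smul_smul]
  congr 2 <;> field_simp

end DiracMass

section SimpleApprox

variable {α M : Type*} [MeasurableSpace α]

theorem sum_range_preimage_singleton (ν : FiniteMeasure α) (T : SimpleFunc α M) :
    ∑ a ∈ T.range, ν (T ⁻¹' {a}) = ν.mass := by
  rw [← ENNReal.coe_inj]
  push_cast
  simpa using T.sum_range_measure_preimage_singleton ν

variable [MeasurableSpace M]

theorem map_simpleFunc_eq_sum_dirac [MeasurableSingletonClass M] (ν : FiniteMeasure α)
    (T : SimpleFunc α M) : ν.map T = ∑ a ∈ T.range, ν (T ⁻¹' {a}) • diracFin a := by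
  apply FiniteMeasure.toMeasure_injective
  rw [FiniteMeasure.toMeasure_map, (Measure.ae_mem_finset_iff_map_eq_sum_dirac
    (s := T.range) T.measurable.aemeasurable).1 (.of_forall T.mem_range_self),
    FiniteMeasure.toMeasure_sum]
  refine Finset.sum_congr rfl fun a _ => ?_
  rw [FiniteMeasure.toMeasure_smul, toMeasure_diracFin,
    ← FiniteMeasure.ennreal_coeFn_eq_coeFn_toMeasure, Measure.coe_nnreal_smul]

theorem tendsto_map_of_forall_tendsto [TopologicalSpace M] [BorelSpace M]
    [TopologicalSpace.PseudoMetrizableSpace M]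
    {T : ℕ → α → M} {S : α → M} (hT : ∀ n, Measurable (T n))
    (h : ∀ x, Tendsto (fun n => T n x) atTop (𝓝 (S x))) (ν : FiniteMeasure α) :
    Tendsto (fun n => ν.map (T n)) atTop (𝓝 (ν.map S)) := by
  have hS : Measurable S := measurable_of_tendsto_metrizable hT (tendsto_pi_nhds.2 h)
  refine FiniteMeasure.tendsto_iff_forall_integral_tendsto.2 fun f => ?_
  have hmap {R : α → M} (hR : Measurable R) :
      ∫ x, f x ∂(ν.map R : Measure M) = ∫ x, f (R x) ∂(ν : Measure α) := by
    rw [FiniteMeasure.toMeasure_map,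
      integral_map hR.aemeasurable f.continuous.aestronglyMeasurable]
  simp only [hmap, hT, hS]
  exact tendsto_integral_of_dominated_convergence (fun _ => ‖f‖)
    (fun n => (f.continuous.measurable.comp (hT n)).aestronglyMeasurable)
    (integrable_const _) (fun n => .of_forall fun x => f.norm_coe_le_norm _)
    (.of_forall fun x => (f.continuous.tendsto _).comp (h x))

end SimpleApprox

section Increments

theorem tendsto_toNNReal_sub (s : ℝ) :
    Tendsto (fun t : ℝ => (t - s).toNNReal) (𝓝[>] s) (𝓝[>] 0) := by
  refine tendsto_nhdsWithin_iff.2 ⟨?_, ?_⟩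
  · have hcont : Continuous fun t : ℝ => (t - s).toNNReal := by fun_prop
    simpa using (hcont.tendsto s).mono_left nhdsWithin_le_nhds
  · filter_upwards [self_mem_nhdsWithin] with t ht
    exact Real.toNNReal_pos.2 (sub_pos.2 ht)

theorem tendsto_div_add_nhdsGT_zero {m : ℝ} (hm : 0 < m) {t : ℝ≥0 → unitInterval}
    (ht : ∀ ε, (t ε : ℝ) = ε / (m + ε)) : Tendsto t (𝓝[>] 0) (𝓝[>] 0) := by
  refine tendsto_nhdsWithin_iff.2 ⟨tendsto_subtype_rng.2 ?_, ?_⟩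
  · have hcont : ContinuousAt (fun ε : ℝ≥0 => (ε : ℝ) / (m + ε)) 0 :=
      ContinuousAt.div (by fun_prop) (by fun_prop) (by simpa using hm.ne')
    simpa [ht] using hcont.tendsto.mono_left nhdsWithin_le_nhds
  · filter_upwards [self_mem_nhdsWithin] with ε (hε : 0 < ε)
    have : (0 : ℝ) < ε := hε
    change (0 : ℝ) < t ε
    rw [ht]
    positivity

variable {M : Type*} [MeasurableSpace M]

theorem IsExtrinsicDeriv.hasDerivWithinAt {u : FiniteMeasure M → ℝ}
    {D : FiniteMeasure M → M → ℝ} (hD : IsExtrinsicDeriv u D) (κ : FiniteMeasure M) (x : M) {s : ℝ}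
    (hs : 0 ≤ s) :
    HasDerivWithinAt (fun t : ℝ => u (κ + t.toNNReal • diracFin x))
      (D (κ + s.toNNReal • diracFin x) x) (Ici s) s := by
  rw [← hasDerivWithinAt_Ioi_iff_Ici, hasDerivWithinAt_iff_tendsto_slope' self_notMem_Ioi]
  refine ((hD _ x).comp (tendsto_toNNReal_sub s)).congr' ?_
  filter_upwards [self_mem_nhdsWithin] with t (ht : s < t)
  have hst : κ + s.toNNReal • diracFin x + (t - s).toNNReal • diracFin x =
      κ + t.toNNReal • diracFin x := by
    rw [add_assoc, ← add_smul, ← Real.toNNReal_add hs (sub_nonneg.2 ht.le), add_sub_cancel]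
  rw [Function.comp_apply, hst, Real.coe_toNNReal _ (sub_nonneg.2 ht.le), slope_def_field]

namespace IsConvexExtrinsicDeriv

variable [Nonempty M] {u : ProbabilityMeasure M → ℝ} {D : ProbabilityMeasure M → M → ℝ}

/-- Adding `ε δ_x` to a measure of mass `m` moves its normalization towards `δ_x` by the fraction
`ε / (m + ε)`. -/
theorem tendsto_normalize (hD : IsConvexExtrinsicDeriv u D) {κ : FiniteMeasure M} (hκ : κ ≠ 0)
    (x : M) :
    Tendsto (fun ε : ℝ≥0 => (u (κ + ε • diracFin x).normalize - u κ.normalize) / (ε : ℝ))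
      (𝓝[>] 0) (𝓝 (D κ.normalize x / κ.mass)) := by
  have hm : (0 : ℝ) < κ.mass := mass_pos hκ
  let t (ε : ℝ≥0) : unitInterval :=
    ⟨ε / (κ.mass + ε), by positivity, div_le_one_of_le₀ (by linarith) (by positivity)⟩
  have hinv : Tendsto (fun ε : ℝ≥0 => ((κ.mass : ℝ) + ε)⁻¹) (𝓝[>] 0) (𝓝 (κ.mass : ℝ)⁻¹) := by
    have hcont : ContinuousAt (fun ε : ℝ≥0 => ((κ.mass : ℝ) + ε)⁻¹) 0 :=
      ContinuousAt.inv₀ (by fun_prop) (by simpa using hm.ne')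
    simpa using hcont.tendsto.mono_left nhdsWithin_le_nhds
  rw [div_eq_mul_inv]
  refine (((hD κ.normalize x).comp
    (tendsto_div_add_nhdsGT_zero hm (t := t) fun _ => rfl)).mul hinv).congr' ?_
  filter_upwards [self_mem_nhdsWithin] with ε (hε : 0 < ε)
  have : (0 : ℝ) < ε := hε
  rw [Function.comp_apply, normalize_add_smul_dirac hκ ε x (t := t ε) rfl]
  simp only [t]
  field_simp

theorem comp_normalize_add (hD : IsConvexExtrinsicDeriv u D) {κ : FiniteMeasure M}
    (hκ : κ ≠ 0) :
    IsExtrinsicDeriv (fun ν => u (κ + ν).normalize)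
      (fun ν x => D (κ + ν).normalize x / (κ + ν).mass) := fun ν x => by
  simpa only [add_assoc] using hD.tendsto_normalize (add_ne_zero_left hκ ν) x

end IsConvexExtrinsicDeriv

variable [TopologicalSpace M] [BorelSpace M]

namespace IsExtrinsicDeriv

variable {u : FiniteMeasure M → ℝ} {D : FiniteMeasure M → M → ℝ} {C : ℝ}

theorem abs_add_smul_dirac_sub_le (hD : IsExtrinsicDeriv u D) (hu : Continuous u)
    (hC : ∀ μ x, |D μ x| ≤ C) (κ : FiniteMeasure M) (x : M) (c : ℝ≥0) :
    |u (κ + c • diracFin x) - u κ| ≤ C * c := by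
  have hcont : Continuous fun t : ℝ => u (κ + t.toNNReal • diracFin x) :=
    hu.comp (continuous_const.add (continuous_real_toNNReal.smul continuous_const))
  simpa using norm_image_sub_le_of_norm_deriv_right_le_segment hcont.continuousOn
    (fun s hs => hD.hasDerivWithinAt κ x hs.1) (fun s _ => hC _ x) c ⟨c.2, le_rfl⟩

theorem abs_add_sum_dirac_sub_le (hD : IsExtrinsicDeriv u D) (hu : Continuous u)
    (hC : ∀ μ x, |D μ x| ≤ C) (κ : FiniteMeasure M) (s : Finset M) (c : M → ℝ≥0) :
    |u (κ + ∑ a ∈ s, c a • diracFin a) - u κ| ≤ C * (∑ a ∈ s, c a : ℝ≥0) := by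
  classical
  induction s using Finset.induction_on with
  | empty => simp
  | insert a s ha ih =>
    rw [Finset.sum_insert ha, Finset.sum_insert ha, add_comm (c a • _), ← add_assoc,
      add_comm (c a), NNReal.coe_add, mul_add, add_comm (C * _)]
    exact (abs_sub_le _ _ _).trans
      (add_le_add (hD.abs_add_smul_dirac_sub_le hu hC (κ + ∑ a ∈ s, c a • diracFin a) a (c a)) ih)

theorem abs_add_sub_le [PolishSpace M] (hD : IsExtrinsicDeriv u D) (hu : Continuous u)
    (hC : ∀ μ x, |D μ x| ≤ C) (κ ν : FiniteMeasure M) : |u (κ + ν) - u κ| ≤ C * ν.mass := by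
  rcases isEmpty_or_nonempty M with hM | ⟨⟨x₀⟩⟩
  · have hν : ν = 0 := FiniteMeasure.toMeasure_injective (Measure.eq_zero_of_isEmpty _)
    simp [hν]
  let _ := TopologicalSpace.upgradeIsCompletelyMetrizable M
  let T : ℕ → SimpleFunc M M := SimpleFunc.approxOn id measurable_id univ x₀ (mem_univ _)
  have hT : Tendsto (fun n => ν.map (T n)) atTop (𝓝 (ν.map id)) :=
    tendsto_map_of_forall_tendsto (fun n => (T n).measurable)
      (fun x => SimpleFunc.tendsto_approxOn measurable_id (mem_univ _) (by simp)) ν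
  have hid : ν.map id = ν := FiniteMeasure.toMeasure_injective (by simp)
  rw [hid] at hT
  refine le_of_tendsto'
    (((hu.tendsto _).comp (tendsto_const_nhds.add hT)).sub_const (u κ)).abs fun n => ?_
  rw [← sum_range_preimage_singleton ν (T n), Function.comp_apply,
    map_simpleFunc_eq_sum_dirac]
  exact hD.abs_add_sum_dirac_sub_le hu hC κ _ _

end IsExtrinsicDeriv

namespace IsConvexExtrinsicDeriv

variable [Nonempty M] {u : ProbabilityMeasure M → ℝ} {D : ProbabilityMeasure M → M → ℝ} {C : ℝ}

theorem abs_normalize_add_sub_le [PolishSpace M] (hD : IsConvexExtrinsicDeriv u D)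
    (hu : Continuous u) (hC : ∀ μ x, |D μ x| ≤ C) {κ : FiniteMeasure M} (hκ : κ ≠ 0)
    (ν : FiniteMeasure M) :
    |u (κ + ν).normalize - u κ.normalize| ≤ C / κ.mass * ν.mass := by
  have hm : (0 : ℝ) < κ.mass := mass_pos hκ
  have hcont : Continuous fun ν => u (κ + ν).normalize :=
    hu.comp <| continuous_iff_continuousAt.2 fun ν =>
      FiniteMeasure.tendsto_normalize_of_tendsto (tendsto_const_nhds.add tendsto_id)
        (add_ne_zero_left hκ ν)
  have hbound (ν x) : |D (κ + ν).normalize x / (κ + ν).mass| ≤ C / κ.mass := by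
    have hle : (κ.mass : ℝ) ≤ (κ + ν).mass := by simp [mass_add]
    rw [abs_div, NNReal.abs_eq]
    exact div_le_div₀ ((abs_nonneg _).trans (hC (κ + ν).normalize x)) (hC _ x) hm hle
  simpa using (hD.comp_normalize_add hκ).abs_add_sub_le hcont hbound 0 ν

end IsConvexExtrinsicDeriv

end Increments

section BoundedContinuous

theorem exists_boundedContinuous_abs_le_one_integral_sub_le {X : Type*} [TopologicalSpace X]
    [PolishSpace X] [MeasurableSpace X] [BorelSpace X] (κ : Measure X) [IsFiniteMeasure κ]
    {s : X → ℝ} (hs : Measurable s) (hs₁ : ∀ x, |s x| ≤ 1) {ε : ℝ} (hε : 0 < ε) :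
    ∃ f : BoundedContinuousFunction X ℝ, (∀ x, |f x| ≤ 1) ∧ ∫ x, |s x - f x| ∂κ ≤ ε := by
  let _ := TopologicalSpace.upgradeIsCompletelyMetrizable X
  have hsi : Integrable s κ := .of_bound hs.aestronglyMeasurable 1 (.of_forall hs₁)
  obtain ⟨g, hg, hgi⟩ := hsi.exists_boundedContinuous_integral_sub_le hε
  have hI : (-1 : ℝ) ≤ 1 := by norm_num
  let clamp (t : ℝ) : ℝ := projIcc (-1) 1 hI t
  have hclamp (t) : |clamp t| ≤ 1 := abs_le.2 (projIcc (-1) 1 hI t).2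
  have hclamp_s (x) : clamp (s x) = s x := by
    simp only [clamp, projIcc_of_mem hI (abs_le.1 (hs₁ x))]
  let f : BoundedContinuousFunction X ℝ := .ofNormedAddCommGroup (fun x => clamp (g x))
    (by fun_prop) 1 (fun x => hclamp (g x))
  have hsf (x) : |s x - f x| ≤ |s x - g x| := by
    rw [← hclamp_s x]
    exact (abs_projIcc_sub_projIcc hI).trans_eq (by rw [hclamp_s])
  exact ⟨f, fun x => hclamp (g x),
    (integral_mono (hsi.sub (f.integrable κ)).abs (hsi.sub hgi).abs hsf).trans hg⟩

end BoundedContinuous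

section CommonPart

theorem tsub_add_tsub_eq_ofReal_abs {a b : ℝ≥0∞} (ha : a ≠ ∞) (hb : b ≠ ∞) :
    (a - b) + (b - a) = ENNReal.ofReal |a.toReal - b.toReal| := by
  wlog hba : b ≤ a generalizing a b
  · rw [add_comm, abs_sub_comm]
    exact this hb ha (le_of_not_ge hba)
  rw [tsub_eq_zero_of_le hba, add_zero, ← ENNReal.toReal_sub_of_le hba ha,
    abs_of_nonneg ENNReal.toReal_nonneg, ENNReal.ofReal_toReal (ENNReal.sub_ne_top ha)]

theorem withDensity_eq_inf_add_tsub {X : Type*} [MeasurableSpace X] (lam : Measure X)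
    {f g : X → ℝ≥0∞} (hf : Measurable f) (hg : Measurable g) :
    lam.withDensity f = lam.withDensity (f ⊓ g) + lam.withDensity (f - g) := by
  rw [← withDensity_add_left (hf.inf hg)]
  congr 1 with x
  exact (add_comm _ _).trans tsub_add_min |>.symm

end CommonPart

section ACSpace

variable {M : Type*} [MeasurableSpace M] {lam : Measure M}

namespace ACFinite

instance instIsFiniteMeasure (μ : ACFinite lam) : IsFiniteMeasure μ.1 := μ.2.1

theorem density_nonneg (μ : ACFinite lam) (x : M) : 0 ≤ μ.density x := ENNReal.toReal_nonneg

theorem measurable_density (μ : ACFinite lam) : Measurable μ.density :=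
  (Measure.measurable_rnDeriv _ _).ennreal_toReal

variable [SigmaFinite lam]

/-- The density, as an element of `L¹`. -/
def toL1 (μ : ACFinite lam) : Lp ℝ 1 lam := μ.integrable_density.toL1 μ.density

theorem isometry_toL1 : Isometry (toL1 : ACFinite lam → Lp ℝ 1 lam) := by
  refine Isometry.of_dist_eq fun μ ν => ?_
  rw [L1.dist_eq_integral_dist]
  refine integral_congr_ae ?_
  filter_upwards [μ.integrable_density.coeFn_toL1, ν.integrable_density.coeFn_toL1] with x hμ hν
  rw [toL1, toL1, hμ, hν, Real.dist_eq]

theorem range_toL1 : range (toL1 : ACFinite lam → Lp ℝ 1 lam) = Ici 0 := by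
  ext f
  rw [mem_Ici, ← Lp.coeFn_nonneg]
  constructor
  · rintro ⟨μ, rfl⟩
    filter_upwards [μ.integrable_density.coeFn_toL1] with x hx
    rw [toL1, hx]
    exact μ.density_nonneg x
  · intro hf
    have hfi : Integrable f lam := L1.integrable_coeFn f
    refine ⟨⟨lam.withDensity fun x => ENNReal.ofReal (f x),
      isFiniteMeasure_withDensity hfi.lintegral_lt_top.ne, withDensity_absolutelyContinuous _ _⟩,
      Lp.ext ((Integrable.coeFn_toL1 _).trans ?_)⟩
    filter_upwards [lam.rnDeriv_withDensity₀ hfi.1.aemeasurable.ennreal_ofReal, hf] with x hx h0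
    exact (congrArg ENNReal.toReal hx).trans (ENNReal.toReal_ofReal h0)

instance instCompleteSpace : CompleteSpace (ACFinite lam) := by
  refine (completeSpace_iff_isComplete_range isometry_toL1.isUniformInducing).2 ?_
  rw [range_toL1]
  exact isClosed_Ici.isComplete

instance instSecondCountableTopology [MeasurableSpace.CountablyGenerated M] :
    SecondCountableTopology (ACFinite lam) :=
  have : Fact ((1 : ℝ≥0∞) ≠ ∞) := ⟨ENNReal.one_ne_top⟩
  isometry_toL1.isEmbedding.secondCountableTopology

theorem dist_def (μ ν : ACFinite lam) : dist μ ν = ∫ x, |μ.density x - ν.density x| ∂lam := rfl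

theorem integral_sub_integral (μ ν : ACFinite lam) {f : M → ℝ} (hf : Measurable f) {C : ℝ}
    (hC : ∀ x, |f x| ≤ C) :
    ∫ x, f x ∂μ.1 - ∫ x, f x ∂ν.1 = ∫ x, (μ.density x - ν.density x) * f x ∂lam := by
  have hint (κ : ACFinite lam) : Integrable (fun x => κ.density x * f x) lam :=
    κ.integrable_density.mul_bdd (c := C) hf.aestronglyMeasurable (.of_forall hC)
  have hintegral (κ : ACFinite lam) : ∫ x, f x ∂κ.1 = ∫ x, κ.density x * f x ∂lam :=
    (integral_rnDeriv_smul κ.2.2).symm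
  rw [hintegral, hintegral, ← integral_sub (hint μ) (hint ν)]
  simp only [sub_mul]

theorem abs_integral_sub_le (μ ν : ACFinite lam) {f : M → ℝ} (hf : Measurable f)
    (hf₁ : ∀ x, |f x| ≤ 1) : |∫ x, f x ∂μ.1 - ∫ x, f x ∂ν.1| ≤ dist μ ν := by
  rw [integral_sub_integral μ ν hf hf₁]
  refine abs_integral_le_integral_abs.trans (integral_mono_of_nonneg
    (.of_forall fun _ => abs_nonneg _) (μ.integrable_density.sub ν.integrable_density).abs
    (.of_forall fun x => ?_))
  simp only [abs_mul]
  exact mul_le_of_le_one_right (abs_nonneg _) (hf₁ x)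

theorem exists_dist_eq_integral_sub (μ ν : ACFinite lam) :
    ∃ s : M → ℝ, Measurable s ∧ (∀ x, |s x| ≤ 1) ∧
      dist μ ν = ∫ x, s x ∂μ.1 - ∫ x, s x ∂ν.1 := by
  let s (x : M) : ℝ := if ν.density x ≤ μ.density x then 1 else -1
  have hs : Measurable s := Measurable.ite
    (measurableSet_le ν.measurable_density μ.measurable_density) measurable_const measurable_const
  have hs₁ (x) : |s x| ≤ 1 := by dsimp only [s]; split_ifs <;> simp
  refine ⟨s, hs, hs₁, ?_⟩
  rw [integral_sub_integral μ ν hs hs₁, dist_def]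
  congr 1 with x
  dsimp only [s]
  split_ifs with h
  · rw [abs_of_nonneg (sub_nonneg.2 h), mul_one]
  · rw [abs_of_neg (sub_neg.2 (not_le.1 h)), mul_neg_one]

theorem exists_boundedContinuous_dist_sub_lt [TopologicalSpace M] [PolishSpace M] [BorelSpace M]
    (μ ν : ACFinite lam) {ε : ℝ} (hε : 0 < ε) :
    ∃ f : BoundedContinuousFunction M ℝ, (∀ x, |f x| ≤ 1) ∧
      dist μ ν - ε < ∫ x, f x ∂μ.1 - ∫ x, f x ∂ν.1 := by
  obtain ⟨s, hs, hs₁, hdist⟩ := μ.exists_dist_eq_integral_sub ν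
  obtain ⟨f, hf₁, hf⟩ :=
    exists_boundedContinuous_abs_le_one_integral_sub_le (μ.1 + ν.1) hs hs₁ (half_pos hε)
  refine ⟨f, hf₁, ?_⟩
  have hint (κ : Measure M) [IsFiniteMeasure κ] : Integrable (fun x => s x - f x) κ :=
    (Integrable.of_bound hs.aestronglyMeasurable 1 (.of_forall hs₁)).sub (f.integrable κ)
  have hle (κ : ACFinite lam) : |∫ x, s x ∂κ.1 - ∫ x, f x ∂κ.1| ≤ ∫ x, |s x - f x| ∂κ.1 := by
    rw [← integral_sub (.of_bound hs.aestronglyMeasurable 1 (.of_forall hs₁)) (f.integrable _)]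
    exact abs_integral_le_integral_abs
  rw [integral_add_measure (hint μ.1).abs (hint ν.1).abs] at hf
  linarith [(abs_le.1 (hle μ)).2, (abs_le.1 (hle ν)).1]

theorem exists_common_part (μ ν : ACFinite lam) : ∃ κ α β : FiniteMeasure M,
    μ.toFin = κ + α ∧ ν.toFin = κ + β ∧ (α.mass : ℝ) + β.mass = dist μ ν := by
  let f := μ.1.rnDeriv lam
  let g := ν.1.rnDeriv lam
  have hf : Measurable f := Measure.measurable_rnDeriv _ _
  have hg : Measurable g := Measure.measurable_rnDeriv _ _
  have hμ : μ.1 = lam.withDensity (f ⊓ g) + lam.withDensity (f - g) :=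
    (Measure.withDensity_rnDeriv_eq _ _ μ.2.2).symm.trans (withDensity_eq_inf_add_tsub lam hf hg)
  have hν : ν.1 = lam.withDensity (f ⊓ g) + lam.withDensity (g - f) := by
    rw [inf_comm]
    exact (Measure.withDensity_rnDeriv_eq _ _ ν.2.2).symm.trans
      (withDensity_eq_inf_add_tsub lam hg hf)
  have hκ := isFiniteMeasure_of_le μ.1 (hμ ▸ Measure.le_add_right le_rfl)
  have hα := isFiniteMeasure_of_le μ.1 (hμ ▸ Measure.le_add_left le_rfl)
  have hβ := isFiniteMeasure_of_le ν.1 (hν ▸ Measure.le_add_left le_rfl)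
  refine ⟨⟨_, hκ⟩, ⟨_, hα⟩, ⟨_, hβ⟩, FiniteMeasure.toMeasure_injective hμ,
    FiniteMeasure.toMeasure_injective hν, ?_⟩
  have hmass : lam.withDensity (f - g) univ + lam.withDensity (g - f) univ =
      ∫⁻ x, ENNReal.ofReal |μ.density x - ν.density x| ∂lam := by
    rw [withDensity_apply _ .univ, withDensity_apply _ .univ, Measure.restrict_univ,
      ← lintegral_add_left (hf.sub hg)]
    refine lintegral_congr_ae ?_
    filter_upwards [μ.1.rnDeriv_lt_top lam, ν.1.rnDeriv_lt_top lam] with x hx hy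
    exact tsub_add_tsub_eq_ofReal_abs hx.ne hy.ne
  have hdist : dist μ ν = (∫⁻ x, ENNReal.ofReal |μ.density x - ν.density x| ∂lam).toReal :=
    integral_eq_lintegral_of_nonneg_ae (.of_forall fun _ => abs_nonneg _)
      (μ.integrable_density.sub ν.integrable_density).abs.1
  rw [hdist, ← hmass, ENNReal.toReal_add (measure_ne_top _ _) (measure_ne_top _ _)]
  rfl

end ACFinite

variable [SigmaFinite lam]

theorem isClosed_isProbabilityMeasure :
    IsClosed {μ : ACFinite lam | IsProbabilityMeasure μ.1} := by
  have hmass : {μ : ACFinite lam | IsProbabilityMeasure μ.1} =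
      (fun μ : ACFinite lam => ∫ _, (1 : ℝ) ∂μ.1) ⁻¹' {1} := by
    ext μ
    simpa [Measure.real, ENNReal.toReal_eq_one_iff] using isProbabilityMeasure_iff
  rw [hmass]
  refine isClosed_singleton.preimage
    (LipschitzWith.of_dist_le_mul (K := 1) fun μ ν => ?_).continuous
  simpa [Real.dist_eq] using μ.abs_integral_sub_le ν (f := fun _ => 1) measurable_const (by simp)

instance instCompleteSpaceACProb : CompleteSpace (ACProb lam) :=
  isClosed_isProbabilityMeasure.completeSpace_coe

end ACSpace

section Chain

theorem tendsto_sub_div_comp {ι : Type*} {l : Filter ι} {F e : ι → ℝ} {a d : ℝ}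
    (he : Tendsto e l (𝓝[≠] 0)) (h : Tendsto (fun i => (F i - a) / e i) l (𝓝 d)) {φ : ℝ → ℝ}
    {φ' : ℝ} (hφ : HasDerivAt φ φ' a) :
    Tendsto (fun i => (φ (F i) - φ a) / e i) l (𝓝 (φ' * d)) := by
  obtain ⟨he₀, hne⟩ := tendsto_nhdsWithin_iff.1 he
  have hF : Tendsto F l (𝓝 a) := by
    have hlim := (h.mul he₀).add_const a
    rw [mul_zero, zero_add] at hlim
    refine hlim.congr' ?_
    filter_upwards [hne] with i hi
    rw [div_mul_cancel₀ _ hi, sub_add_cancel]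
  have hslope : Tendsto (fun i => dslope φ a (F i)) l (𝓝 φ') := by
    have hlim := (continuousAt_dslope_same.2 hφ.differentiableAt).tendsto.comp hF
    rwa [dslope_same, hφ.deriv] at hlim
  refine (hslope.mul h).congr fun i => ?_
  rw [← sub_smul_dslope φ a (F i), smul_eq_mul]
  ring

theorem exists_bound_comp {φ : ℝ → ℝ} (hφ : ContDiff ℝ 1 φ) (C : ℝ) :
    ∃ K, ∀ a d : ℝ, |a| + |d| ≤ C → |φ a| + |deriv φ a * d| ≤ K := by
  obtain ⟨K₁, h₁⟩ := (isCompact_Icc (a := -C) (b := C)).exists_bound_of_continuousOn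
    hφ.continuous.continuousOn
  obtain ⟨K₂, h₂⟩ := (isCompact_Icc (a := -C) (b := C)).exists_bound_of_continuousOn
    (hφ.continuous_deriv le_rfl).continuousOn
  refine ⟨K₁ + K₂ * C, fun a d h => ?_⟩
  have ha : a ∈ Icc (-C) C := abs_le.1 (by linarith [abs_nonneg d])
  rw [abs_mul]
  exact add_le_add (h₁ a ha) (mul_le_mul (h₂ a ha) (by linarith [abs_nonneg a]) (abs_nonneg _)
    ((norm_nonneg _).trans (h₂ a ha)))

theorem tendsto_nnreal_coe_nhdsGT_zero : Tendsto (fun ε : ℝ≥0 => (ε : ℝ)) (𝓝[>] 0) (𝓝[≠] 0) :=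
  NNReal.continuous_coe.continuousWithinAt.tendsto_nhdsWithin fun _ hε =>
    NNReal.coe_ne_zero.2 (ne_of_gt hε)

theorem tendsto_unitInterval_coe_nhdsGT_zero :
    Tendsto (fun ε : unitInterval => (ε : ℝ)) (𝓝[>] 0) (𝓝[≠] 0) :=
  continuous_subtype_val.continuousWithinAt.tendsto_nhdsWithin fun _ hε =>
    unitInterval.coe_ne_zero.2 (ne_of_gt hε)

theorem contDiff_arctan_sub (c : ℝ) : ContDiff ℝ 1 fun s => Real.arctan (s - c) :=
  Real.contDiff_arctan.comp (contDiff_id.sub contDiff_const)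

theorem abs_deriv_arctan_sub_le (c s : ℝ) : |deriv (fun t => Real.arctan (t - c)) s| ≤ 1 := by
  have hLip : LipschitzWith 1 fun t : ℝ => Real.arctan (t - c) :=
    .of_dist_le_mul fun t r => by
      simpa [Real.dist_eq] using abs_arctan_sub_arctan_le (t - c) (r - c)
  exact norm_deriv_le_of_lipschitz hLip

theorem StableComp.map_funLeft {E E' : Type*} {𝓒 : Submodule ℝ (E → ℝ)} (h : StableComp 𝓒)
    (g : E' → E) : StableComp (𝓒.map (LinearMap.funLeft ℝ ℝ g)) := by
  rintro _ ⟨u, hu, rfl⟩ φ hφ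
  exact ⟨_, h u hu φ hφ, rfl⟩

end Chain

section ArctanIntegral

variable {M : Type*} [TopologicalSpace M] [PolishSpace M] [MeasurableSpace M] [BorelSpace M]
  {lam : Measure M} [SigmaFinite lam]

theorem ACFinite.exists_arctan_integral_approx (ν μ : ACFinite lam) {ε : ℝ} (hε : 0 < ε) :
    ∃ f : BoundedContinuousFunction M ℝ,
      BddLip 4 (fun γ : ACFinite lam => Real.arctan (∫ x, f x ∂γ.1 - ∫ x, f x ∂ν.1)) ∧
      (∀ γ : ACFinite lam, Real.arctan (∫ x, f x ∂γ.1 - ∫ x, f x ∂ν.1) ≤ arctanDist ν γ) ∧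
      arctanDist ν μ - ε < Real.arctan (∫ x, f x ∂μ.1 - ∫ x, f x ∂ν.1) := by
  obtain ⟨f, hf₁, hlt⟩ := μ.exists_boundedContinuous_dist_sub_lt ν hε
  have hle (γ η : ACFinite lam) := γ.abs_integral_sub_le η f.continuous.measurable hf₁
  refine ⟨f, .of_abs_sub_le (A := 2) (B := 1) (fun _ => abs_arctan_le_two _) (fun γ η _ => ?_)
    (by norm_num) (by norm_num), fun γ => ?_, ?_⟩
  · refine (abs_arctan_sub_arctan_le _ _).trans ?_
    rw [sub_sub_sub_cancel_right, one_mul]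
    exact hle γ η
  · exact Real.arctan_strictMono.monotone ((le_abs_self _).trans (hle γ ν))
  · have harctan := abs_arctan_sub_arctan_le (dist μ ν) (∫ x, f x ∂μ.1 - ∫ x, f x ∂ν.1)
    rw [abs_of_nonneg (a := dist μ ν - _) (sub_nonneg.2 ((le_abs_self _).trans (hle μ ν)))]
      at harctan
    rw [arctanDist]
    linarith [le_of_abs_le harctan]

end ArctanIntegral

section CoreFinite

variable {M : Type*} [MeasurableSpace M]

theorem IsExtrinsicDeriv.comp {u : FiniteMeasure M → ℝ} {D : FiniteMeasure M → M → ℝ}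
    (hD : IsExtrinsicDeriv u D) {φ : ℝ → ℝ} (hφ : Differentiable ℝ φ) :
    IsExtrinsicDeriv (fun μ => φ (u μ)) (fun μ x => deriv φ (u μ) * D μ x) := fun μ x =>
  tendsto_sub_div_comp tendsto_nnreal_coe_nhdsGT_zero (hD μ x) hφ.differentiableAt.hasDerivAt

variable [TopologicalSpace M] [BorelSpace M]

theorem isExtrinsicDeriv_integral (f : BoundedContinuousFunction M ℝ) :
    IsExtrinsicDeriv (fun μ => ∫ x, f x ∂(μ : Measure M)) (fun _ x => f x) := fun μ x => by
  refine tendsto_const_nhds.congr' ?_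
  filter_upwards [self_mem_nhdsWithin] with ε (hε : 0 < ε)
  have hε' : (ε : ℝ) ≠ 0 := NNReal.coe_ne_zero.2 hε.ne'
  rw [FiniteMeasure.toMeasure_add, integral_add_measure (f.integrable _) (f.integrable _),
    FiniteMeasure.toMeasure_smul, toMeasure_diracFin, integral_smul_nnreal_measure,
    integral_dirac' _ _ f.continuous.stronglyMeasurable, add_sub_cancel_left, NNReal.smul_def,
    smul_eq_mul, mul_div_cancel_left₀ _ hε']

theorem stableComp_CbE1Finite : StableComp (CbE1Finite M) := by
  rintro u ⟨hu, D, hD, hDc, C, hC⟩ φ hφ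
  obtain ⟨K, hK⟩ := exists_bound_comp hφ C
  exact ⟨hφ.continuous.comp hu, _, hD.comp (hφ.differentiable one_ne_zero),
    ((hφ.continuous_deriv le_rfl).comp (hu.comp continuous_fst)).mul hDc, K,
    fun μ x => hK _ _ (hC μ x)⟩

theorem arctan_integral_mem_CbE1Finite (f : BoundedContinuousFunction M ℝ) (c : ℝ) :
    (fun μ : FiniteMeasure M => Real.arctan (∫ x, f x ∂(μ : Measure M) - c)) ∈ CbE1Finite M := by
  have hI : Continuous fun μ : FiniteMeasure M => ∫ x, f x ∂(μ : Measure M) :=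
    FiniteMeasure.continuous_integral_boundedContinuousFunction f
  have hφ := contDiff_arctan_sub c
  refine ⟨hφ.continuous.comp hI, _,
    (isExtrinsicDeriv_integral f).comp (hφ.differentiable one_ne_zero),
    ((hφ.continuous_deriv le_rfl).comp (hI.comp continuous_fst)).mul
      (f.continuous.comp continuous_snd), 2 + ‖f‖, fun μ x => ?_⟩
  rw [abs_mul]
  exact add_le_add (abs_arctan_le_two _) <|
    (mul_le_of_le_one_left (abs_nonneg _) (abs_deriv_arctan_sub_le c _)).trans
      (f.norm_coe_le_norm x)

theorem exists_abs_le_of_mem_CbE1Finite {u : FiniteMeasure M → ℝ} (hu : u ∈ CbE1Finite M) :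
    ∃ C, ∀ μ, |u μ| ≤ C := by
  obtain ⟨-, D, -, -, C, hC⟩ := hu
  rcases isEmpty_or_nonempty M with hM | ⟨⟨x⟩⟩
  · refine ⟨|u 0|, fun μ => ?_⟩
    have hμ : μ = 0 := FiniteMeasure.toMeasure_injective (Measure.eq_zero_of_isEmpty _)
    rw [hμ]
  · exact ⟨C, fun μ => by linarith [hC μ x, abs_nonneg (D μ x)]⟩

variable [PolishSpace M] {lam : Measure M} [SigmaFinite lam]

theorem exists_lipschitz_of_mem_CbE1Finite {u : FiniteMeasure M → ℝ} (hu : u ∈ CbE1Finite M) :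
    ∃ C, ∀ μ ν : ACFinite lam, |u μ.toFin - u ν.toFin| ≤ C * dist μ ν := by
  obtain ⟨hc, D, hD, -, C, hC⟩ := hu
  have hDC (μ x) : |D μ x| ≤ C := by linarith [hC μ x, abs_nonneg (u μ)]
  refine ⟨C, fun μ ν => ?_⟩
  obtain ⟨κ, α, β, hμ, hν, hdist⟩ := μ.exists_common_part ν
  have hα := hD.abs_add_sub_le hc hDC κ α
  have hβ := hD.abs_add_sub_le hc hDC κ β
  rw [abs_sub_comm] at hβ
  rw [hμ, hν, ← hdist, mul_add]
  exact (abs_sub_le _ (u κ) _).trans (add_le_add hα hβ)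

theorem lipschitzCore_coreFinite : LipschitzCore (coreFinite lam) where
  bddLip := by
    rintro _ ⟨u, hu, rfl⟩
    obtain ⟨A, hA⟩ := exists_abs_le_of_mem_CbE1Finite hu
    obtain ⟨B, hB⟩ := exists_lipschitz_of_mem_CbE1Finite (lam := lam) hu
    exact ⟨max (2 * A) B, .of_abs_sub_le (fun μ => hA μ.toFin) (fun μ ν _ => hB μ ν)
      (le_max_left _ _) (le_max_right _ _)⟩
  stableComp := stableComp_CbE1Finite.map_funLeft _
  approx_arctanDist ν μ ε hε := by
    obtain ⟨f, hLip, hle, hlt⟩ := ν.exists_arctan_integral_approx μ hε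
    exact ⟨_, ⟨_, arctan_integral_mem_CbE1Finite f (∫ x, f x ∂ν.1), rfl⟩, hLip, hle, hlt⟩

end CoreFinite

section CoreProb

variable {M : Type*} [MeasurableSpace M]

theorem IsConvexExtrinsicDeriv.comp {u : ProbabilityMeasure M → ℝ}
    {D : ProbabilityMeasure M → M → ℝ} (hD : IsConvexExtrinsicDeriv u D) {φ : ℝ → ℝ}
    (hφ : Differentiable ℝ φ) :
    IsConvexExtrinsicDeriv (fun μ => φ (u μ)) (fun μ x => deriv φ (u μ) * D μ x) := fun μ x =>
  tendsto_sub_div_comp tendsto_unitInterval_coe_nhdsGT_zero (hD μ x)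
    hφ.differentiableAt.hasDerivAt

theorem normalize_eq_toProb [Nonempty M] {lam : Measure M} {μ : ACProb lam} {κ : FiniteMeasure M}
    (hμ : μ.1.toFin = κ) : κ.normalize = μ.toProb :=
  hμ ▸ ProbabilityMeasure.toFiniteMeasure_normalize_eq_self μ.toProb

variable [TopologicalSpace M] [BorelSpace M]

theorem integral_mixDirac (f : BoundedContinuousFunction M ℝ) (ε : unitInterval)
    (μ : ProbabilityMeasure M) (x : M) :
    ∫ y, f y ∂(mixDirac ε μ x : Measure M) =
      (1 - (ε : ℝ)) * ∫ y, f y ∂(μ : Measure M) + ε * f x := by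
  change ∫ y, f y ∂(ENNReal.ofReal (1 - (ε : ℝ)) • (μ : Measure M) +
    ENNReal.ofReal (ε : ℝ) • Measure.dirac x) = _
  rw [integral_add_measure ((f.integrable _).smul_measure ENNReal.ofReal_ne_top)
    ((f.integrable _).smul_measure ENNReal.ofReal_ne_top), integral_smul_measure,
    integral_smul_measure, integral_dirac' _ _ f.continuous.stronglyMeasurable,
    ENNReal.toReal_ofReal (sub_nonneg.2 ε.2.2), ENNReal.toReal_ofReal ε.2.1, smul_eq_mul,
    smul_eq_mul]

theorem isConvexExtrinsicDeriv_integral (f : BoundedContinuousFunction M ℝ) :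
    IsConvexExtrinsicDeriv (fun μ => ∫ x, f x ∂(μ : Measure M))
      (fun μ x => f x - ∫ y, f y ∂(μ : Measure M)) := fun μ x => by
  refine tendsto_const_nhds.congr' ?_
  filter_upwards [self_mem_nhdsWithin] with ε (hε : 0 < ε)
  have hε' : (ε : ℝ) ≠ 0 := unitInterval.coe_ne_zero.2 hε.ne'
  rw [integral_mixDirac]
  field_simp
  ring

theorem integral_mem_CbE1Prob (f : BoundedContinuousFunction M ℝ) :
    (fun μ : ProbabilityMeasure M => ∫ x, f x ∂(μ : Measure M)) ∈ CbE1Prob M := by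
  have hI : Continuous fun μ : ProbabilityMeasure M => ∫ x, f x ∂(μ : Measure M) :=
    ProbabilityMeasure.continuous_integral_boundedContinuousFunction f
  have hb (μ : ProbabilityMeasure M) : |∫ x, f x ∂(μ : Measure M)| ≤ ‖f‖ :=
    f.norm_integral_le_norm (μ : Measure M)
  exact ⟨hI, _, isConvexExtrinsicDeriv_integral f,
    (f.continuous.comp continuous_snd).sub (hI.comp continuous_fst), ‖f‖ + (‖f‖ + ‖f‖),
    fun μ x => add_le_add (hb μ) ((abs_sub _ _).trans (add_le_add (f.norm_coe_le_norm x) (hb μ)))⟩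

theorem stableComp_CbE1Prob : StableComp (CbE1Prob M) := by
  rintro u ⟨hu, D, hD, hDc, C, hC⟩ φ hφ
  obtain ⟨K, hK⟩ := exists_bound_comp hφ C
  exact ⟨hφ.continuous.comp hu, _, hD.comp (hφ.differentiable one_ne_zero),
    ((hφ.continuous_deriv le_rfl).comp (hu.comp continuous_fst)).mul hDc, K,
    fun μ x => hK _ _ (hC μ x)⟩

theorem exists_abs_le_of_mem_CbE1Prob {u : ProbabilityMeasure M → ℝ} (hu : u ∈ CbE1Prob M) :
    ∃ C, ∀ μ, |u μ| ≤ C := by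
  obtain ⟨-, D, -, -, C, hC⟩ := hu
  refine ⟨C, fun μ => ?_⟩
  obtain ⟨x⟩ := μ.nonempty
  linarith [hC μ x, abs_nonneg (D μ x)]

variable [PolishSpace M] {lam : Measure M} [SigmaFinite lam]

/-- The common part of two probability measures at distance at most `1` has mass at least `1 / 2`,
so normalizing it costs at most a factor `2`. -/
theorem exists_lipschitz_of_mem_CbE1Prob {u : ProbabilityMeasure M → ℝ} (hu : u ∈ CbE1Prob M) :
    ∃ C, ∀ μ ν : ACProb lam, dist μ ν ≤ 1 → |u μ.toProb - u ν.toProb| ≤ C * dist μ ν := by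
  obtain ⟨hc, D, hD, -, C, hC⟩ := hu
  have hDC (μ x) : |D μ x| ≤ C := by linarith [hC μ x, abs_nonneg (u μ)]
  refine ⟨2 * C, fun μ ν hd => ?_⟩
  have hM : Nonempty M := μ.toProb.nonempty
  have hC₀ : 0 ≤ C := (abs_nonneg _).trans (hDC μ.toProb hM.some)
  obtain ⟨κ, α, β, hμ, hν, hdist⟩ := μ.1.exists_common_part ν.1
  change (α.mass : ℝ) + β.mass = dist μ ν at hdist
  have hmass {η : ACProb lam} {γ : FiniteMeasure M} (hη : η.1.toFin = κ + γ) :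
      (κ.mass : ℝ) + γ.mass = 1 := by
    rw [← NNReal.coe_add, ← mass_add, ← hη]
    exact_mod_cast η.toProb.mass_toFiniteMeasure
  have hκ : (1 / 2 : ℝ) ≤ κ.mass := by linarith [hmass hμ, hmass hν]
  have hκ₀ : κ ≠ 0 := by
    rw [← FiniteMeasure.mass_nonzero_iff, ← NNReal.coe_ne_zero]
    linarith
  have hle : C / κ.mass ≤ 2 * C := by
    rw [div_le_iff₀ (by linarith)]
    nlinarith
  have hα := hD.abs_normalize_add_sub_le hc hDC hκ₀ α
  have hβ := hD.abs_normalize_add_sub_le hc hDC hκ₀ β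
  rw [abs_sub_comm] at hβ
  rw [← normalize_eq_toProb hμ, ← normalize_eq_toProb hν, ← hdist, mul_add]
  exact (abs_sub_le _ (u κ.normalize) _).trans (add_le_add
    (hα.trans (mul_le_mul_of_nonneg_right hle α.mass.2))
    (hβ.trans (mul_le_mul_of_nonneg_right hle β.mass.2)))

theorem lipschitzCore_coreProb : LipschitzCore (coreProb lam) where
  bddLip := by
    rintro _ ⟨u, hu, rfl⟩
    obtain ⟨A, hA⟩ := exists_abs_le_of_mem_CbE1Prob hu
    obtain ⟨B, hB⟩ := exists_lipschitz_of_mem_CbE1Prob (lam := lam) hu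
    exact ⟨max (2 * A) B, .of_abs_sub_le (fun μ => hA μ.toProb) hB
      (le_max_left _ _) (le_max_right _ _)⟩
  stableComp := stableComp_CbE1Prob.map_funLeft _
  approx_arctanDist ν μ ε hε := by
    obtain ⟨f, hLip, hle, hlt⟩ := ν.1.exists_arctan_integral_approx μ.1 hε
    exact ⟨_, ⟨_, stableComp_CbE1Prob _ (integral_mem_CbE1Prob f) _
      (contDiff_arctan_sub (∫ x, f x ∂ν.1.1)), rfl⟩,
      ⟨fun γ => hLip.abs_le γ.1, fun p => hLip.abs_jumpDiff_le (p.1.1, p.2.1)⟩,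
      fun γ => hle γ.1, hlt⟩

end CoreProb

end ExtrinsicJump

end

theorem theorem3p1 {M : Type*} [TopologicalSpace M] [PolishSpace M] [MeasurableSpace M]
    [BorelSpace M] (lam : Measure M) [SigmaFinite lam] :
    (∀ (Λ : Measure (ACFinite lam)) [IsProbabilityMeasure Λ]
        (J : Measure (ACFinite lam × ACFinite lam)) [SigmaFinite J],
      ∫⁻ p, ENNReal.ofReal (min 1 (dist p.1 p.2 ^ 2)) ∂J < ∞ → J ≪ Λ.prod Λ →
      (∀ u ∈ coreFinite lam, MemLp u 2 Λ) ∧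
      (∀ u ∈ coreFinite lam, ∀ v ∈ coreFinite lam,
        Integrable (fun p => (u p.1 - u p.2) * (v p.1 - v p.2)) J) ∧
      IsClosable Λ (coreFinite lam) (jumpForm J) ∧
      ∃ 𝓔 : L2Form Λ, IsClosure Λ (coreFinite lam) (jumpForm J) 𝓔 ∧
        𝓔.IsDirichlet ∧ 𝓔.IsQuasiRegular) ∧
    (∀ (Λ : Measure (ACProb lam)) [IsProbabilityMeasure Λ]
        (J : Measure (ACProb lam × ACProb lam)) [SigmaFinite J],
      ∫⁻ p, ENNReal.ofReal (min 1 (dist p.1 p.2 ^ 2)) ∂J < ∞ → J ≪ Λ.prod Λ →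
      (∀ u ∈ coreProb lam, MemLp u 2 Λ) ∧
      (∀ u ∈ coreProb lam, ∀ v ∈ coreProb lam,
        Integrable (fun p => (u p.1 - u p.2) * (v p.1 - v p.2)) J) ∧
      IsClosable Λ (coreProb lam) (jumpForm J) ∧
      ∃ 𝓔 : L2Form Λ, IsClosure Λ (coreProb lam) (jumpForm J) 𝓔 ∧
        𝓔.IsDirichlet ∧ 𝓔.IsQuasiRegular) :=
  ⟨fun _ _ _ _ hJ1 hJ => lipschitzCore_coreFinite.jumpForm_closure hJ1 hJ,
    fun _ _ _ _ hJ1 hJ => lipschitzCore_coreProb.jumpForm_closure hJ1 hJ⟩
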